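/- Let $s=\{\xi\in\mathbb C^{\mathbb N}: |\xi|_q:=(\sum_{j\ge1}|\xi_j|^2j^{2q})^{1/2}<\infty\ \forall q\in\mathbb N_0\}$ be the Fréchet space of rapidly decreasing sequences, and let $s'=\{\xi\in\mathbb C^{\mathbb N}: |\xi|'_q:=(\sum_{j\ge1}|\xi_j|^2j^{-2q})^{1/2}<\infty\text{ for some }q\in\mathbb N_0\}$ carry the (locally convex) inductive limit topology given by the norms $|\cdot|'_q$. Let $L(s',s)$ be the space of continuous linear operators $s'\to s$, with the topology given by the norms $\|x\|_q=\sup_{|\xi|'_q\le1}|x\xi|_q$, $q\in\mathbb N_0$, and with the product $xy=x\circ j\circ y$, where $j:s\hookrightarrow s'$ is the inclusion. Via $\ell_2\hookrightarrow s'\to s\hookrightarrow\ell_2$ the algebra $L(s',s)$ embeds into $L(\ell_2)$; its involution $x\mapsto x^*$ is the Hilbert space adjoint. A projection in $L(s',s)$ is an element whose image in $L(\ell_2)$ is an orthogonal projection. Let $A$ be a closed commutative $*$-subalgebra of $L(s',s)$, and let $\mathcal M$ be the set of minimal elements of the set of nonzero projections belonging to $A$, with respect to the order $P\preceq Q\Leftrightarrow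 PQ=QP=P$. Then $\mathcal M$ is an (at most countable) Schauder basis of $A$, in any enumeration, called the canonical Schauder basis of $A$, and the following assertions are equivalent: (i) $A$ is maximal commutative, i.e. it is not contained in any larger closed commutative $*$-subalgebra of $L(s',s)$; (ii) the canonical Schauder basis $\mathcal M=\{P_n\}_{n\in\mathbb N}$ of $A$ is a complete sequence of pairwise orthogonal one-dimensional projections belonging to $L(s',s)$, where complete means that there is no nonzero projection $P\in L(s',s)$ with $P_nP=0$ for every $n\in\mathbb N$; (iii) $A=A'$, where $A'=\{x\in L(s',s): xy=yx\text{ for all }y\in A\}$ is the commutant of $A$. -/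

import Mathlib

open Filter Topology

noncomputable section

namespace SmoothOperators

/-! ### Weighted square-summable sequences

Sequences are indexed by `j : ℕ`, where `j` stands for the position `j + 1 ∈ {1, 2, …}`. -/

/-- `|ξ|_q = (∑_j |ξ_j|² j^{2q})^{1/2}` for `q ∈ ℤ`. -/
def hNorm (q : ℤ) (ξ : ℕ → ℂ) : ℝ :=
  √(∑' j, ‖ξ j‖ ^ 2 * ((j : ℝ) + 1) ^ (2 * q))

/-- The weighted sequence, whose `ℓ²`-norm is `|ξ|_q`. -/
def weighted (q : ℤ) (ξ : ℕ → ℂ) : ℕ → ℂ := fun j => ((((j : ℝ) + 1) ^ q : ℝ) : ℂ) * ξ j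

theorem norm_weighted_sq (q : ℤ) (ξ : ℕ → ℂ) (j : ℕ) :
    ‖weighted q ξ j‖ ^ 2 = ‖ξ j‖ ^ 2 * ((j : ℝ) + 1) ^ (2 * q) := by
  have h : (0 : ℝ) < (j : ℝ) + 1 := by positivity
  rw [weighted, norm_mul, Complex.norm_real, Real.norm_of_nonneg (zpow_pos h q).le, mul_pow,
    mul_comm, two_mul, zpow_add₀ h.ne', sq (((j : ℝ) + 1) ^ q)]

theorem memℓp_weighted_iff (q : ℤ) (ξ : ℕ → ℂ) :
    Memℓp (weighted q ξ) 2 ↔ Summable fun j => ‖ξ j‖ ^ 2 * ((j : ℝ) + 1) ^ (2 * q) := by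
  rw [memℓp_gen_iff (by norm_num)]
  refine summable_congr fun j => ?_
  rw [← norm_weighted_sq]
  norm_num

/-- The space of sequences with `|ξ|_q < ∞`. -/
def hSpace (q : ℤ) : Submodule ℂ (ℕ → ℂ) where
  carrier := {ξ | Summable fun j => ‖ξ j‖ ^ 2 * ((j : ℝ) + 1) ^ (2 * q)}
  add_mem' := by
    intro ξ η hξ hη
    rw [Set.mem_ofPred_eq, ← memℓp_weighted_iff] at *
    convert hξ.add hη using 1
    funext j
    simp [weighted, mul_add]
  zero_mem' := by simp [summable_zero]
  smul_mem' := by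
    intro c ξ hξ
    rw [Set.mem_ofPred_eq, ← memℓp_weighted_iff] at *
    convert hξ.const_smul c using 1
    funext j
    simp [weighted, mul_left_comm]

/-- The linear map `ξ ↦ (j^q ξ_j)_j` into `ℓ²`. -/
def toLp (q : ℤ) : hSpace q →ₗ[ℂ] lp (fun _ : ℕ => ℂ) 2 where
  toFun ξ := ⟨weighted q ξ, (memℓp_weighted_iff q ξ).2 ξ.2⟩
  map_add' ξ η := Subtype.ext <| funext fun j => mul_add _ (ξ.1 j) (η.1 j)
  map_smul' c ξ := Subtype.ext <| funext fun j => mul_left_comm _ c (ξ.1 j)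

theorem norm_toLp (q : ℤ) (ξ : hSpace q) : ‖toLp q ξ‖ = hNorm q ξ := by
  rw [lp.norm_eq_tsum_rpow (by norm_num), hNorm, Real.sqrt_eq_rpow]
  congr 1
  · refine tsum_congr fun j => ?_
    rw [← norm_weighted_sq]
    norm_num [toLp]

theorem hSpace_mono {p q : ℤ} (h : p ≤ q) : hSpace q ≤ hSpace p := by
  intro ξ hξ
  refine Summable.of_nonneg_of_le (fun j => by positivity) (fun j => ?_) hξ
  have : (1 : ℝ) ≤ (j : ℝ) + 1 := by simp
  gcongr

theorem hNorm_mono {p q : ℤ} (h : p ≤ q) {ξ : ℕ → ℂ} (hξ : ξ ∈ hSpace q) :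
    hNorm p ξ ≤ hNorm q ξ := by
  refine Real.sqrt_le_sqrt (Summable.tsum_le_tsum (fun j => ?_) (hSpace_mono h hξ) hξ)
  have : (1 : ℝ) ≤ (j : ℝ) + 1 := by simp
  gcongr

theorem hNorm_nonneg (q : ℤ) (ξ : ℕ → ℂ) : 0 ≤ hNorm q ξ := Real.sqrt_nonneg _

/-! ### The Fréchet space `s` of rapidly decreasing sequences -/

/-- `s` as a space of sequences. -/
def rapidSubmodule : Submodule ℂ (ℕ → ℂ) where
  carrier := {ξ | ∀ q : ℕ, ξ ∈ hSpace q}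
  add_mem' h₁ h₂ q := add_mem (h₁ q) (h₂ q)
  zero_mem' _ := zero_mem _
  smul_mem' c _ h q := Submodule.smul_mem _ c (h q)

/-- The space `s`; a separate type, so that it does not inherit the topology of pointwise
convergence. -/
def RapidSeq : Type := rapidSubmodule

instance : AddCommGroup RapidSeq := inferInstanceAs (AddCommGroup rapidSubmodule)
instance : Module ℂ RapidSeq := inferInstanceAs (Module ℂ rapidSubmodule)

/-- The underlying sequence of an element of `s`. -/
def RapidSeq.val : RapidSeq →ₗ[ℂ] (ℕ → ℂ) := rapidSubmodule.subtype

theorem RapidSeq.mem (ξ : RapidSeq) (q : ℕ) : ξ.val ∈ hSpace q := ξ.2 q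

/-- An element of `s` as an element of the `q`-th step. -/
def RapidSeq.toH (q : ℕ) : RapidSeq →ₗ[ℂ] hSpace q :=
  LinearMap.codRestrict _ RapidSeq.val fun ξ => ξ.mem q

/-- The norms `|·|_q` on `s`. -/
def rapidNorm : SeminormFamily ℂ RapidSeq ℕ := fun q =>
  (normSeminorm ℂ (lp (fun _ : ℕ => ℂ) 2)).comp ((toLp q).comp (RapidSeq.toH q))

theorem rapidNorm_apply (q : ℕ) (ξ : RapidSeq) : rapidNorm q ξ = hNorm q ξ.val :=
  norm_toLp q (RapidSeq.toH q ξ)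

/-- The topology of `s`, given by the norms `|·|_q`, `q ∈ ℕ₀`. -/
instance : TopologicalSpace RapidSeq := rapidNorm.moduleFilterBasis.topology

theorem rapid_withSeminorms : WithSeminorms rapidNorm := ⟨rfl⟩

instance : IsTopologicalAddGroup RapidSeq := rapid_withSeminorms.topologicalAddGroup
instance : ContinuousSMul ℂ RapidSeq := rapid_withSeminorms.continuousSMul

/-! ### The space `s'` of slowly increasing sequences -/

/-- `s'` as a space of sequences. -/
def slowSubmodule : Submodule ℂ (ℕ → ℂ) where
  carrier := {ξ | ∃ q : ℕ, ξ ∈ hSpace (-(q : ℤ))}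
  add_mem' := by
    rintro ξ η ⟨p, hp⟩ ⟨q, hq⟩
    exact ⟨max p q, add_mem (hSpace_mono (by simp) hp) (hSpace_mono (by simp) hq)⟩
  zero_mem' := ⟨0, zero_mem _⟩
  smul_mem' := by
    rintro c ξ ⟨p, hp⟩
    exact ⟨p, Submodule.smul_mem _ c hp⟩

/-- The space `s'`; a separate type, so that it does not inherit the topology of pointwise
convergence. -/
def SlowSeq : Type := slowSubmodule

instance : AddCommGroup SlowSeq := inferInstanceAs (AddCommGroup slowSubmodule)
instance : Module ℂ SlowSeq := inferInstanceAs (Module ℂ slowSubmodule)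

/-- The underlying sequence of an element of `s'`. -/
def SlowSeq.val : SlowSeq →ₗ[ℂ] (ℕ → ℂ) := slowSubmodule.subtype

/-- The seminorms on `s'` whose restriction to every step `{ξ : |ξ|'_q < ∞}` is continuous with
respect to `|·|'_q`, where `|·|'_q = |·|_{-q}`. -/
def SlowSeminorm : Type :=
  {p : Seminorm ℂ SlowSeq //
    ∀ q : ℕ, ∃ C : ℝ, ∀ ξ : SlowSeq, ξ.val ∈ hSpace (-(q : ℤ)) → p ξ ≤ C * hNorm (-(q : ℤ)) ξ.val}

instance : Nonempty SlowSeminorm := ⟨⟨0, fun _ => ⟨0, fun _ _ => by simp⟩⟩⟩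

/-- The family of all such seminorms. -/
def slowFamily : SeminormFamily ℂ SlowSeq SlowSeminorm := fun p => p.1

/-- The (locally convex) inductive limit topology of `s'`: it is generated by all seminorms whose
restrictions to the steps are continuous. -/
instance : TopologicalSpace SlowSeq := slowFamily.moduleFilterBasis.topology

theorem slow_withSeminorms : WithSeminorms slowFamily := ⟨rfl⟩

instance : IsTopologicalAddGroup SlowSeq := slow_withSeminorms.topologicalAddGroup
instance : ContinuousSMul ℂ SlowSeq := slow_withSeminorms.continuousSMul

theorem slow_bound (p : Seminorm ℂ SlowSeq) (hp : Continuous p) (q : ℕ) :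
    ∃ C : ℝ, ∀ ξ : SlowSeq, ξ.val ∈ hSpace (-(q : ℤ)) → p ξ ≤ C * hNorm (-(q : ℤ)) ξ.val := by
  obtain ⟨t, D, -, h⟩ := Seminorm.bound_of_continuous slow_withSeminorms p hp
  choose C hC using fun i : SlowSeminorm => i.2 q
  refine ⟨D * ∑ i ∈ t, C i, fun ξ hξ => (h ξ).trans ?_⟩
  rw [mul_assoc]
  change (D : ℝ) * (t.sup slowFamily) ξ ≤ _
  refine mul_le_mul_of_nonneg_left ?_ D.2
  refine (Seminorm.le_def.1 (Seminorm.finset_sup_le_sum slowFamily t) ξ).trans ?_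
  have hs : (∑ i ∈ t, slowFamily i) ξ = ∑ i ∈ t, slowFamily i ξ :=
    map_sum (AddMonoidHom.mk' (fun r : Seminorm ℂ SlowSeq => r ξ) fun _ _ => rfl) _ _
  rw [hs, Finset.sum_mul]
  exact Finset.sum_le_sum fun i _ => hC i ξ hξ

/-! ### The canonical inclusions `s ⊆ ℓ² ⊆ s'` -/

/-- The Hilbert space `ℓ²`. -/
abbrev L2 : Type := lp (fun _ : ℕ => ℂ) 2

theorem weighted_zero (ξ : ℕ → ℂ) : weighted 0 ξ = ξ := by
  funext j
  simp [weighted]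

theorem mem_hSpace_zero (ξ : L2) : (ξ : ℕ → ℂ) ∈ hSpace 0 := by
  refine (memℓp_weighted_iff 0 _).1 ?_
  rw [weighted_zero]
  exact ξ.2

theorem hNorm_zero (ξ : L2) : hNorm 0 (ξ : ℕ → ℂ) = ‖ξ‖ := by
  rw [← norm_toLp 0 ⟨ξ, mem_hSpace_zero ξ⟩]
  congr 1
  exact Subtype.ext (weighted_zero _)

/-- The inclusion `s ⊆ ℓ²`, as a linear map. -/
def rapidToL2Lin : RapidSeq →ₗ[ℂ] L2 where
  toFun ξ := ⟨ξ.val, by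
    have := (memℓp_weighted_iff 0 ξ.val).2 (ξ.mem 0)
    rwa [weighted_zero] at this⟩
  map_add' _ _ := rfl
  map_smul' _ _ := rfl

theorem norm_rapidToL2Lin (ξ : RapidSeq) : ‖rapidToL2Lin ξ‖ = rapidNorm 0 ξ := by
  rw [rapidNorm_apply, ← hNorm_zero]
  rfl

/-- The inclusion `s ⊆ ℓ²`. -/
def rapidToL2 : RapidSeq →L[ℂ] L2 where
  toLinearMap := rapidToL2Lin
  cont := by
    refine rapid_withSeminorms.continuous_of_isBounded (norm_withSeminorms ℂ L2) rapidToL2Lin ?_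
    intro _
    refine ⟨{0}, 1, fun ξ => ?_⟩
    simp [norm_rapidToL2Lin]

/-- The inclusion `ℓ² ⊆ s'`, as a linear map. -/
def l2ToSlowLin : L2 →ₗ[ℂ] SlowSeq where
  toFun ξ := ⟨ξ, 0, mem_hSpace_zero ξ⟩
  map_add' _ _ := rfl
  map_smul' _ _ := rfl

/-- The inclusion `ℓ² ⊆ s'`. -/
def l2ToSlow : L2 →L[ℂ] SlowSeq where
  toLinearMap := l2ToSlowLin
  cont := by
    refine (norm_withSeminorms ℂ L2).continuous_of_isBounded slow_withSeminorms l2ToSlowLin ?_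
    intro p
    obtain ⟨C, hC⟩ := p.2 0
    refine ⟨{0}, C.toNNReal, fun ξ => ?_⟩
    have h1 := hC (l2ToSlowLin ξ) (mem_hSpace_zero ξ)
    have h2 : hNorm (-((0 : ℕ) : ℤ)) (l2ToSlowLin ξ).val = ‖ξ‖ := hNorm_zero ξ
    rw [h2] at h1
    have h3 : C * ‖ξ‖ ≤ C.toNNReal * ‖ξ‖ :=
      mul_le_mul_of_nonneg_right (Real.le_coe_toNNReal C) (norm_nonneg _)
    simpa [slowFamily, NNReal.smul_def] using h1.trans h3

/-- The canonical inclusion `j : s → s'`. -/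
def rapidToSlow : RapidSeq →L[ℂ] SlowSeq := l2ToSlow.comp rapidToL2

/-! ### The algebra `L(s', s)` -/

/-- The space `L(s', s)` of continuous linear operators from `s'` to `s`; a separate type, whose
topology is defined below. -/
def SmoothOp : Type := SlowSeq →L[ℂ] RapidSeq

instance : AddCommGroup SmoothOp := inferInstanceAs (AddCommGroup (SlowSeq →L[ℂ] RapidSeq))
instance : Module ℂ SmoothOp := inferInstanceAs (Module ℂ (SlowSeq →L[ℂ] RapidSeq))

/-- An element of `L(s', s)` as a continuous linear map. -/
def SmoothOp.toCLM (x : SmoothOp) : SlowSeq →L[ℂ] RapidSeq := x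

theorem SmoothOp.ext {x y : SmoothOp} (h : ∀ ξ, x.toCLM ξ = y.toCLM ξ) : x = y :=
  ContinuousLinearMap.ext h

/-- The product of `L(s', s)`: `x · y = x ∘ j ∘ y`. -/
instance : Mul SmoothOp := ⟨fun x y => x.toCLM.comp (rapidToSlow.comp y.toCLM)⟩

theorem SmoothOp.mul_toCLM (x y : SmoothOp) (ξ : SlowSeq) :
    (x * y).toCLM ξ = x.toCLM (rapidToSlow (y.toCLM ξ)) := rfl

instance : NonUnitalRing SmoothOp :=
  { (inferInstance : AddCommGroup SmoothOp), (inferInstance : Mul SmoothOp) with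
    left_distrib := fun x y z => SmoothOp.ext fun ξ =>
      map_add (x.toCLM.comp rapidToSlow) (y.toCLM ξ) (z.toCLM ξ)
    right_distrib := fun _ _ _ => rfl
    zero_mul := fun _ => rfl
    mul_zero := fun x => SmoothOp.ext fun _ => map_zero (x.toCLM.comp rapidToSlow)
    mul_assoc := fun _ _ _ => rfl }

instance : IsScalarTower ℂ SmoothOp SmoothOp := ⟨fun _ _ _ => rfl⟩

instance : SMulCommClass ℂ SmoothOp SmoothOp := ⟨fun c x y => SmoothOp.ext fun ξ =>
  (map_smul (x.toCLM.comp rapidToSlow) c (y.toCLM ξ)).symm⟩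

/-- The unit ball of `|·|'_q` in `s'`. -/
def slowBall (q : ℕ) : Set SlowSeq :=
  {ξ | ξ.val ∈ hSpace (-(q : ℤ)) ∧ hNorm (-(q : ℤ)) ξ.val ≤ 1}

theorem zero_mem_slowBall (q : ℕ) : (0 : SlowSeq) ∈ slowBall q := by
  simp [slowBall, hNorm]

theorem bddAbove_opNorm (q : ℕ) (x : SmoothOp) :
    BddAbove ((fun ξ => rapidNorm q (x.toCLM ξ)) '' slowBall q) := by
  obtain ⟨C, hC⟩ := slow_bound ((rapidNorm q).comp x.toCLM.toLinearMap)
    ((rapid_withSeminorms.continuous_seminorm q).comp x.toCLM.continuous) q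
  refine ⟨|C|, ?_⟩
  rintro _ ⟨ξ, ⟨h1, h2⟩, rfl⟩
  calc rapidNorm q (x.toCLM ξ) ≤ C * hNorm (-(q : ℤ)) ξ.val := hC ξ h1
    _ ≤ |C| * 1 := mul_le_mul (le_abs_self C) h2 (hNorm_nonneg _ _) (abs_nonneg _)
    _ = |C| := mul_one _

/-- The norms `‖x‖_q = sup {|xξ|_q : |ξ|'_q ≤ 1}` on `L(s', s)`. -/
def opNorm : SeminormFamily ℂ SmoothOp ℕ := fun q =>
  Seminorm.ofSMulLE (fun x => sSup ((fun ξ => rapidNorm q (x.toCLM ξ)) '' slowBall q))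
    (by
      have h : (fun ξ => rapidNorm q ((0 : SmoothOp).toCLM ξ)) = fun _ => 0 :=
        funext fun _ => map_zero (rapidNorm q)
      rw [h, Set.Nonempty.image_const ⟨0, zero_mem_slowBall q⟩, csSup_singleton])
    (by
      intro x y
      refine csSup_le (Set.Nonempty.image _ ⟨0, zero_mem_slowBall q⟩) ?_
      rintro _ ⟨ξ, hξ, rfl⟩
      exact (map_add_le_add (rapidNorm q) (x.toCLM ξ) (y.toCLM ξ)).trans
        (add_le_add (le_csSup (bddAbove_opNorm q x) ⟨ξ, hξ, rfl⟩)
          (le_csSup (bddAbove_opNorm q y) ⟨ξ, hξ, rfl⟩)))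
    (by
      intro c x
      refine csSup_le (Set.Nonempty.image _ ⟨0, zero_mem_slowBall q⟩) ?_
      rintro _ ⟨ξ, hξ, rfl⟩
      exact (map_smul_eq_mul (rapidNorm q) c (x.toCLM ξ)).le.trans
        (mul_le_mul_of_nonneg_left (le_csSup (bddAbove_opNorm q x) ⟨ξ, hξ, rfl⟩)
          (norm_nonneg c)))

theorem opNorm_apply (q : ℕ) (x : SmoothOp) :
    opNorm q x = sSup ((fun ξ => rapidNorm q (x.toCLM ξ)) '' slowBall q) := rfl

/-- The topology of `L(s', s)`, given by the norms `‖·‖_q`, `q ∈ ℕ₀`. -/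
instance : TopologicalSpace SmoothOp := opNorm.moduleFilterBasis.topology

theorem smoothOp_withSeminorms : WithSeminorms opNorm := ⟨rfl⟩

instance : IsTopologicalAddGroup SmoothOp := smoothOp_withSeminorms.topologicalAddGroup
instance : ContinuousSMul ℂ SmoothOp := smoothOp_withSeminorms.continuousSMul

/-- The canonical embedding `L(s', s) → L(ℓ²)`, given by `ℓ² ⊆ s' → s ⊆ ℓ²`. -/
def SmoothOp.toL2 (x : SmoothOp) : L2 →L[ℂ] L2 := rapidToL2.comp (x.toCLM.comp l2ToSlow)

/-! ### Closed commutative `*`-subalgebras, projections, the canonical Schauder basis -/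

/-- `A` is a closed commutative `*`-subalgebra of `L(s', s)`. The involution of `L(s', s)` is the
Hilbert space adjoint, so closedness under it means that the adjoint on `ℓ²` of every element of
`A` comes from an element of `A`. -/
structure IsClosedCommStarSubalgebra (A : NonUnitalSubalgebra ℂ SmoothOp) : Prop where
  isClosed : IsClosed (A : Set SmoothOp)
  comm : ∀ x ∈ A, ∀ y ∈ A, x * y = y * x
  star_mem : ∀ x ∈ A, ∃ y ∈ A, y.toL2 = ContinuousLinearMap.adjoint x.toL2

/-- `A` is maximal commutative: a closed commutative `*`-subalgebra that is not contained in any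
larger closed commutative `*`-subalgebra. -/
def IsMaximalCommutative (A : NonUnitalSubalgebra ℂ SmoothOp) : Prop :=
  Maximal IsClosedCommStarSubalgebra A

/-- `P` is a projection: its image in `L(ℓ²)` is an orthogonal projection. -/
def IsProjection (P : SmoothOp) : Prop := IsStarProjection P.toL2

/-- `P` has a one-dimensional range. -/
def IsOneDimensional (P : SmoothOp) : Prop :=
  Module.finrank ℂ (LinearMap.range P.toL2.toLinearMap) = 1

/-- The nonzero projections belonging to `A`. -/
def projections (A : NonUnitalSubalgebra ℂ SmoothOp) : Set SmoothOp :=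
  {P | P ∈ A ∧ IsProjection P ∧ P ≠ 0}

/-- The canonical Schauder basis of `A`: the set of minimal elements of the set of nonzero
projections in `A`, with respect to the order `Q ≼ P ↔ Q P = P Q = Q`. -/
def canonicalSchauderBasis (A : NonUnitalSubalgebra ℂ SmoothOp) : Set SmoothOp :=
  {P | P ∈ projections A ∧ ∀ Q ∈ projections A, Q * P = Q → P * Q = Q → Q = P}

/-- The at most countable set `M` is a Schauder basis of the subspace `A`. If `M` is finite, this
means that every element of `A` is a unique linear combination of the elements of `M`. If `M` is
infinite, it means that, for every enumeration `(P_n)` of `M`, every `x ∈ A` is the sum of a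
convergent series `∑ c_n P_n` with unique coefficients `c_n`. -/
structure IsSchauderBasis (M : Set SmoothOp) (A : Submodule ℂ SmoothOp) : Prop where
  subset : M ⊆ A
  countable : M.Countable
  finite_case : ∀ (n : ℕ) (P : Fin n → SmoothOp), Function.Injective P → Set.range P = M →
    ∀ x ∈ A, ∃! c : Fin n → ℂ, ∑ i, c i • P i = x
  infinite_case : ∀ P : ℕ → SmoothOp, Function.Injective P → Set.range P = M →
    ∀ x ∈ A, ∃! c : ℕ → ℂ,
      Tendsto (fun n => ∑ i ∈ Finset.range n, c i • P i) atTop (𝓝 x)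

/-- `(P_n)` is a complete sequence of nonzero pairwise orthogonal projections in `L(s', s)`. -/
structure IsCompleteSequence (P : ℕ → SmoothOp) : Prop where
  isProjection : ∀ n, IsProjection (P n)
  ne_zero : ∀ n, P n ≠ 0
  orthogonal : ∀ m n, m ≠ n → P m * P n = 0
  complete : ∀ Q : SmoothOp, IsProjection Q → (∀ n, P n * Q = 0) → Q = 0

end SmoothOperators

end

/-! Elements of L(s',s) are exactly the matrices whose entries decay faster than every power of
(j+1)(k+1) (`isRapidMatrix_entry`, `exists_entry_eq`). A sequence with uniform decay bounds
converges as soon as its entries do (`tendsto_of_entry`). The limits of operators constructed below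
are obtained this way.

The spectral theorem is replaced by one limit: for self-adjoint y of norm 1 on ℓ², the even powers
of y decrease, as quadratic forms, to a nonzero projection Q with y²Q = Q. It lies in every closed
subalgebra containing y (`exists_spectral_projection`). Projections have finite trace, and the trace
drops by at least 1 on a proper subprojection, so a minimal projection lies below every nonzero one
in A. Minimality gives xP ∈ ℂP for x ∈ A (`exists_mul_eq_smul`), and no nonzero element of A is
killed by all minimal projections. Hence x = ∑ cₙPₙ with cₙ read off from xPₙ = cₙPₙ; the series
converges because its partial sums are Sₙx = xSₙ with Sₙ a projection.

(i) ⇒ (ii): a projection F with xF = Fx ∈ ℂF for all x ∈ A can be adjoined to A, so it already lies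
in a maximal A. This forces minimal projections to have rank one and excludes projections orthogonal
to A. (ii) ⇒ (iii): for x ∈ A', xPₙ = PₙxPₙ is a multiple of Pₙ; the corresponding series has a sum
in A, and completeness forces it to equal x. (iii) ⇒ (i): a commutative algebra containing A lies in
A'. -/

noncomputable section

namespace SmoothOperators

/-! ### Estimates for weighted sequences -/

/-- The sum of the inverse squares. -/
def invSqSum : ℝ := ∑' j : ℕ, 1 / ((j : ℝ) + 1) ^ 2

theorem summable_inv_sq : Summable fun j : ℕ => 1 / ((j : ℝ) + 1) ^ 2 := by
  have := (summable_nat_add_iff (f := fun j : ℕ => 1 / (j : ℝ) ^ 2) 1).2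
    (Real.summable_one_div_nat_pow.2 one_lt_two)
  simpa using this

theorem invSqSum_nonneg : 0 ≤ invSqSum := tsum_nonneg fun _ => by positivity

theorem weighted_weighted (p q : ℤ) (ξ : ℕ → ℂ) :
    weighted p (weighted q ξ) = weighted (p + q) ξ := by
  funext j
  have h : ((j : ℝ) + 1) ≠ 0 := by positivity
  simp only [weighted, zpow_add₀ h, Complex.ofReal_mul, mul_assoc]

theorem norm_mul_le_hNorm {q : ℤ} {ξ : ℕ → ℂ} (hξ : ξ ∈ hSpace q) (j : ℕ) :
    ‖ξ j‖ * ((j : ℝ) + 1) ^ q ≤ hNorm q ξ := by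
  have h : (0 : ℝ) < (j : ℝ) + 1 := by positivity
  refine Real.le_sqrt_of_sq_le ?_
  rw [mul_pow, ← zpow_natCast (((j : ℝ) + 1) ^ q), ← zpow_mul, mul_comm q]
  exact hξ.le_tsum j fun i _ => by positivity

/-- One extra power of j leaves the square-summable factor 1/(j+1), so weighted sup bounds control
weighted ℓ² norms. -/
theorem mem_hSpace_of_bound {q : ℕ} {η : ℕ → ℂ} {B : ℝ}
    (h : ∀ j, ‖η j‖ * ((j : ℝ) + 1) ^ (q + 1) ≤ B) :
    η ∈ hSpace q ∧ hNorm q η ≤ B * √invSqSum := by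
  have hB : 0 ≤ B := (by positivity : (0 : ℝ) ≤ _).trans (h 0)
  have key : ∀ j, ‖η j‖ ^ 2 * ((j : ℝ) + 1) ^ (2 * (q : ℤ)) ≤
      B ^ 2 * (1 / ((j : ℝ) + 1) ^ 2) := by
    intro j
    have hj : (0 : ℝ) < (j : ℝ) + 1 := by positivity
    have h1 : (‖η j‖ * ((j : ℝ) + 1) ^ (q + 1)) ^ 2 ≤ B ^ 2 :=
      pow_le_pow_left₀ (by positivity) (h j) 2
    have h2 : ((j : ℝ) + 1) ^ (2 * (q : ℤ)) = (((j : ℝ) + 1) ^ q) ^ 2 := by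
      rw [← pow_mul, mul_comm q]
      exact_mod_cast zpow_natCast ((j : ℝ) + 1) (2 * q)
    rw [h2, mul_one_div, le_div_iff₀ (by positivity)]
    calc _ = (‖η j‖ * ((j : ℝ) + 1) ^ (q + 1)) ^ 2 := by ring
      _ ≤ _ := h1
  have hs : η ∈ hSpace q :=
    Summable.of_nonneg_of_le (fun j => by positivity) key (summable_inv_sq.mul_left _)
  refine ⟨hs, ?_⟩
  rw [hNorm, ← Real.sqrt_sq hB, ← Real.sqrt_mul (sq_nonneg B), invSqSum, ← tsum_mul_left]
  exact Real.sqrt_le_sqrt (hs.tsum_le_tsum key (summable_inv_sq.mul_left _))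

/-- By `norm_mul_le_hNorm`, ξ grows at most like (k+1)^q; the two spare powers in the decay of `a`
make the pairing absolutely summable. -/
theorem pairing_bound {q : ℕ} {a ξ : ℕ → ℂ} {C : ℝ}
    (ha : ∀ k, ‖a k‖ * ((k : ℝ) + 1) ^ (q + 2) ≤ C) (hξ : ξ ∈ hSpace (-(q : ℤ))) :
    Summable (fun k => ξ k * a k) ∧
      ‖∑' k, ξ k * a k‖ ≤ C * hNorm (-(q : ℤ)) ξ * invSqSum := by
  have key : ∀ k, ‖ξ k * a k‖ ≤ C * hNorm (-(q : ℤ)) ξ * (1 / ((k : ℝ) + 1) ^ 2) := by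
    intro k
    have hk : (0 : ℝ) < (k : ℝ) + 1 := by positivity
    have h1 := norm_mul_le_hNorm hξ k
    rw [zpow_neg, zpow_natCast] at h1
    rw [norm_mul, mul_one_div, le_div_iff₀ (by positivity)]
    calc _ = (‖a k‖ * ((k : ℝ) + 1) ^ (q + 2)) * (‖ξ k‖ * (((k : ℝ) + 1) ^ q)⁻¹) := by
          field_simp
          ring
      _ ≤ _ := mul_le_mul (ha k) h1 (by positivity)
          ((by positivity : (0 : ℝ) ≤ _).trans (ha k))
  have hs := summable_inv_sq.mul_left (C * hNorm (-(q : ℤ)) ξ)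
  refine ⟨Summable.of_norm_bounded hs key, ?_⟩
  refine (tsum_of_norm_bounded hs.hasSum key).trans_eq ?_
  rw [tsum_mul_left, invSqSum]

/-! ### Matrix entries -/

/-- The `k`-th unit vector of `ℓ²`. -/
def unitVec (k : ℕ) : L2 := lp.single 2 k 1

theorem unitVec_apply (k j : ℕ) : (unitVec k : ℕ → ℂ) j = if j = k then 1 else 0 := by
  rw [unitVec, lp.single_apply, Pi.single_apply]

theorem norm_unitVec (k : ℕ) : ‖unitVec k‖ = 1 := by
  rw [unitVec, lp.norm_single (by norm_num), norm_one]

theorem inner_unitVec (j : ℕ) (ξ : L2) : inner ℂ (unitVec j) ξ = (ξ : ℕ → ℂ) j := by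
  rw [unitVec, lp.inner_single_left]
  simp

theorem unitVec_ext {S T : L2 →L[ℂ] L2}
    (h : ∀ j k, (S (unitVec k) : ℕ → ℂ) j = (T (unitVec k) : ℕ → ℂ) j) : S = T := by
  refine ContinuousLinearMap.ext fun ξ => ?_
  have hξ := lp.hasSum_single (p := 2) (by norm_num) ξ
  refine (hξ.mapL S).unique ?_
  convert hξ.mapL T using 2 with k
  have h1 : lp.single 2 k ((ξ : ℕ → ℂ) k) = (ξ : ℕ → ℂ) k • unitVec k := by
    rw [unitVec, ← lp.single_smul, smul_eq_mul, mul_one]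
  have h2 : S (unitVec k) = T (unitVec k) := lp.ext (funext fun j => h j k)
  rw [h1, map_smul, map_smul, h2]

theorem hSpace_unitVec (q : ℤ) (k : ℕ) :
    (unitVec k : ℕ → ℂ) ∈ hSpace q ∧ hNorm q (unitVec k) = ((k : ℝ) + 1) ^ q := by
  have hk : (0 : ℝ) < (k : ℝ) + 1 := by positivity
  have h : HasSum (fun j => ‖(unitVec k : ℕ → ℂ) j‖ ^ 2 * ((j : ℝ) + 1) ^ (2 * q))
      (((k : ℝ) + 1) ^ (2 * q)) := by
    convert hasSum_ite_eq k (((k : ℝ) + 1) ^ (2 * q)) using 2 with j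
    rw [unitVec_apply]
    split_ifs with hj <;> simp [hj]
  refine ⟨h.summable, ?_⟩
  rw [hNorm, h.tsum_eq, mul_comm, zpow_mul]
  exact_mod_cast Real.sqrt_sq (zpow_pos hk q).le

theorem hNorm_weighted (q : ℤ) (ξ : L2) :
    weighted q ξ ∈ hSpace (-q) ∧ hNorm (-q) (weighted q ξ) = ‖ξ‖ := by
  have h : weighted (-q) (weighted q ξ) = ξ := by
    rw [weighted_weighted, neg_add_cancel, weighted_zero]
  have hm : weighted q ξ ∈ hSpace (-q) := by
    refine (memℓp_weighted_iff _ _).1 ?_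
    rw [h]
    exact ξ.2
  refine ⟨hm, ?_⟩
  rw [← norm_toLp (-q) ⟨_, hm⟩]
  congr 1
  exact Subtype.ext h

/-- The isometry `(ξ_j) ↦ (j^q ξ_j)` of `ℓ²` onto the `q`-th step of `s'`, as a map into `s'`. -/
def weightedL (q : ℕ) : L2 →L[ℂ] SlowSeq where
  toFun ξ := ⟨weighted q ξ, q, (hNorm_weighted q ξ).1⟩
  map_add' ξ η := Subtype.ext <| funext fun j => mul_add _ (ξ j) (η j)
  map_smul' c ξ := Subtype.ext <| funext fun j => mul_left_comm _ c (ξ j)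
  cont := by
    let f : L2 →ₗ[ℂ] SlowSeq :=
      { toFun := fun ξ => ⟨weighted q ξ, q, (hNorm_weighted q ξ).1⟩
        map_add' := fun ξ η => Subtype.ext <| funext fun j => mul_add _ (ξ j) (η j)
        map_smul' := fun c ξ => Subtype.ext <| funext fun j => mul_left_comm _ c (ξ j) }
    refine (norm_withSeminorms ℂ L2).continuous_of_isBounded slow_withSeminorms f ?_
    intro p
    obtain ⟨C, hC⟩ := p.2 q
    refine ⟨{0}, C.toNNReal, fun ξ => ?_⟩
    have h1 := hC (f ξ) (hNorm_weighted q ξ).1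
    have h2 : hNorm (-(q : ℤ)) (f ξ).val = ‖ξ‖ := (hNorm_weighted q ξ).2
    rw [h2] at h1
    have h3 : C * ‖ξ‖ ≤ C.toNNReal * ‖ξ‖ :=
      mul_le_mul_of_nonneg_right (Real.le_coe_toNNReal C) (norm_nonneg _)
    simpa [slowFamily, NNReal.smul_def] using h1.trans h3

/-- The matrix entries of an element of `L(s', s)`. -/
def entry (x : SmoothOp) (j k : ℕ) : ℂ := (x.toL2 (unitVec k) : ℕ → ℂ) j

/-- Each ξ lies in some step of s', which `weightedL` identifies with ℓ². There ξ is the sum of its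
coordinates along unit vectors, and the continuous operator is applied termwise. -/
theorem hasSum_entry (x : SmoothOp) (ξ : SlowSeq) (j : ℕ) :
    HasSum (fun k => ξ.val k * entry x j k) ((x.toCLM ξ).val j) := by
  obtain ⟨q, hq⟩ := ξ.2
  let η : L2 := toLp (-(q : ℤ)) ⟨ξ.val, hq⟩
  have hW : weightedL q η = ξ := by
    refine Subtype.ext ?_
    change weighted q (weighted (-(q : ℤ)) ξ.val) = ξ.val
    rw [weighted_weighted, add_neg_cancel, weighted_zero]
  have hs := lp.hasSum_single (p := 2) (by norm_num) η
  have h := hs.mapL ((innerSL ℂ (unitVec j)).comp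
    (rapidToL2.comp (x.toCLM.comp (weightedL q))))
  have e1 : ∀ ζ : L2, ((innerSL ℂ (unitVec j)).comp
    (rapidToL2.comp (x.toCLM.comp (weightedL q)))) ζ = (x.toCLM (weightedL q ζ)).val j :=
    fun ζ => inner_unitVec j _
  simp only [e1, hW] at h
  suffices hk : ∀ k, ξ.val k * entry x j k =
      (x.toCLM (weightedL q (lp.single 2 k ((η : ℕ → ℂ) k)))).val j by
    simp only [hk]
    exact h
  intro k
  have e2 : weightedL q (lp.single 2 k ((η : ℕ → ℂ) k)) = ξ.val k • l2ToSlow (unitVec k) := by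
    refine Subtype.ext (funext fun i => ?_)
    change weighted q (lp.single 2 k ((η : ℕ → ℂ) k) : L2) i = ξ.val k * (unitVec k : ℕ → ℂ) i
    rw [unitVec_apply, weighted, lp.single_apply, Pi.single_apply]
    split_ifs with hi
    · subst hi
      have := congrFun (congrArg SlowSeq.val hW) i
      rw [mul_one, ← this]
      rfl
    · simp
  rw [e2, map_smul, map_smul]
  rfl

theorem SmoothOp.ext_entry {x y : SmoothOp} (h : ∀ j k, entry x j k = entry y j k) : x = y := by
  refine SmoothOp.ext fun ξ => Subtype.ext (funext fun j => ?_)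
  refine (hasSum_entry x ξ j).unique ?_
  simp only [h]
  exact hasSum_entry y ξ j

theorem toL2_injective : Function.Injective SmoothOp.toL2 := fun x y h =>
  SmoothOp.ext_entry fun j k => by rw [entry, entry, h]

/-- The weight of the matrix position `(j, k)`. -/
def weight (j k : ℕ) : ℝ := ((j : ℝ) + 1) * ((k : ℝ) + 1)

theorem one_le_weight (j k : ℕ) : 1 ≤ weight j k :=
  one_le_mul_of_one_le_of_one_le (by simp) (by simp)

/-- The matrix `a` decreases rapidly. -/
def IsRapidMatrix (a : ℕ → ℕ → ℂ) : Prop := ∀ q : ℕ, ∃ C : ℝ, ∀ j k, ‖a j k‖ * weight j k ^ q ≤ C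

theorem step_bound (x : SmoothOp) (p q : ℕ) : ∃ C : ℝ, ∀ ξ : SlowSeq,
    ξ.val ∈ hSpace (-(q : ℤ)) → rapidNorm p (x.toCLM ξ) ≤ C * hNorm (-(q : ℤ)) ξ.val :=
  slow_bound ((rapidNorm p).comp x.toCLM.toLinearMap)
    ((rapid_withSeminorms.continuous_seminorm p).comp x.toCLM.continuous) q

theorem norm_toL2_unitVec_bound (x : SmoothOp) (q : ℕ) :
    ∃ C : ℝ, ∀ k, ‖x.toL2 (unitVec k)‖ * ((k : ℝ) + 1) ^ q ≤ C := by
  obtain ⟨C, hC⟩ := step_bound x 0 q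
  refine ⟨C, fun k => ?_⟩
  have hk : (0 : ℝ) < (k : ℝ) + 1 := by positivity
  have h := hC (l2ToSlow (unitVec k)) (hSpace_unitVec _ k).1
  have e : hNorm (-(q : ℤ)) (l2ToSlow (unitVec k)).val = ((k : ℝ) + 1) ^ (-(q : ℤ)) :=
    (hSpace_unitVec _ k).2
  rw [e, ← norm_rapidToL2Lin, zpow_neg, zpow_natCast, ← div_eq_mul_inv,
    le_div_iff₀ (by positivity)] at h
  exact h

/-- On the unit vector e_k, of dual norm (k+1)^(-q), continuity gives the decay in k; a single
coordinate of the image in s gives the decay in j. -/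
theorem isRapidMatrix_entry (x : SmoothOp) : IsRapidMatrix (entry x) := by
  intro q
  obtain ⟨C, hC⟩ := step_bound x q q
  refine ⟨C, fun j k => ?_⟩
  have hk : (0 : ℝ) < (k : ℝ) + 1 := by positivity
  have h := hC (l2ToSlow (unitVec k)) (hSpace_unitVec _ k).1
  have e : hNorm (-(q : ℤ)) (l2ToSlow (unitVec k)).val = ((k : ℝ) + 1) ^ (-(q : ℤ)) :=
    (hSpace_unitVec _ k).2
  rw [e, rapidNorm_apply, zpow_neg, zpow_natCast, ← div_eq_mul_inv,
    le_div_iff₀ (by positivity)] at h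
  have h1 := norm_mul_le_hNorm (RapidSeq.mem (x.toCLM (l2ToSlow (unitVec k))) q) j
  rw [zpow_natCast] at h1
  rw [weight, mul_pow, ← mul_assoc]
  exact (mul_le_mul_of_nonneg_right h1 (by positivity)).trans h

theorem exists_entry_eq {a : ℕ → ℕ → ℂ} (ha : IsRapidMatrix a) :
    ∃ x : SmoothOp, entry x = a := by
  have bound : ∀ p q : ℕ, ∃ C, ∀ ξ ∈ hSpace (-(q : ℤ)), ∀ j,
      Summable (fun k => ξ k * a j k) ∧
      ‖∑' k, ξ k * a j k‖ * ((j : ℝ) + 1) ^ (p + 1) ≤ C * hNorm (-(q : ℤ)) ξ := by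
    intro p q
    -- The p + 1 powers of j feed `mem_hSpace_of_bound`, the q + 2 powers of k feed `pairing_bound`.
    obtain ⟨C, hC⟩ := ha (max (p + 1) (q + 2))
    refine ⟨C * invSqSum, fun ξ hξ j => ?_⟩
    have hj : (1 : ℝ) ≤ (j : ℝ) + 1 := by simp
    have hj0 : (0 : ℝ) < (j : ℝ) + 1 := by positivity
    have hb : ∀ k, ‖a j k‖ * ((k : ℝ) + 1) ^ (q + 2) ≤ C / ((j : ℝ) + 1) ^ (p + 1) := by
      intro k
      have hk : (1 : ℝ) ≤ (k : ℝ) + 1 := by simp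
      rw [le_div_iff₀ (by positivity)]
      refine le_trans ?_ (hC j k)
      rw [weight, mul_pow, mul_assoc, mul_comm (((k : ℝ) + 1) ^ (q + 2))]
      gcongr <;> first | assumption | exact le_max_left _ _ | exact le_max_right _ _
    obtain ⟨h1, h2⟩ := pairing_bound hb hξ
    refine ⟨h1, ?_⟩
    calc _ ≤ (C / ((j : ℝ) + 1) ^ (p + 1) * hNorm (-(q : ℤ)) ξ * invSqSum) *
          ((j : ℝ) + 1) ^ (p + 1) := by gcongr
      _ = _ := by field_simp
  have hsum : ∀ (ξ : SlowSeq) (j : ℕ), Summable (fun k => ξ.val k * a j k) := by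
    intro ξ j
    obtain ⟨q, hq⟩ := ξ.2
    exact ((bound 0 q).choose_spec _ hq j).1
  have hmem : ∀ ξ : SlowSeq, (fun j => ∑' k, ξ.val k * a j k) ∈ rapidSubmodule := by
    intro ξ p
    obtain ⟨q, hq⟩ := ξ.2
    obtain ⟨C, hC⟩ := bound p q
    exact (mem_hSpace_of_bound fun j => (hC _ hq j).2).1
  let f : SlowSeq →ₗ[ℂ] RapidSeq :=
    { toFun := fun ξ => ⟨fun j => ∑' k, ξ.val k * a j k, hmem ξ⟩
      map_add' := fun ξ η => Subtype.ext <| funext fun j => by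
        change ∑' k, (ξ + η).val k * a j k = ∑' k, ξ.val k * a j k + ∑' k, η.val k * a j k
        rw [← (hsum ξ j).tsum_add (hsum η j)]
        simp [add_mul]
      map_smul' := fun c ξ => Subtype.ext <| funext fun j => by
        change ∑' k, (c • ξ).val k * a j k = c * ∑' k, ξ.val k * a j k
        rw [← tsum_mul_left]
        simp [mul_assoc] }
  have hf : Continuous f := by
    refine slow_withSeminorms.continuous_of_isBounded rapid_withSeminorms f fun p => ?_
    -- The pulled-back seminorm is itself one of the seminorms defining the inductive limit, so
    -- continuity reduces to the bound on each step.
    let i : SlowSeminorm := ⟨(rapidNorm p).comp f, fun q => by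
      obtain ⟨C, hC⟩ := bound p q
      refine ⟨C * √invSqSum, fun ξ hξ => ?_⟩
      rw [Seminorm.comp_apply, rapidNorm_apply]
      refine (mem_hSpace_of_bound fun j => (hC _ hξ j).2).2.trans_eq ?_
      ring⟩
    refine ⟨{i}, 1, ?_⟩
    rw [Finset.sup_singleton, one_smul]
    exact le_rfl
  refine ⟨(⟨f, hf⟩ : SlowSeq →L[ℂ] RapidSeq), funext fun j => funext fun k => ?_⟩
  change ∑' i, (unitVec k : ℕ → ℂ) i * a j i = a j k
  rw [tsum_eq_single k]
  · simp [unitVec_apply]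
  · intro i hi
    simp [unitVec_apply, hi]

theorem opNorm_le_of_entry (x : SmoothOp) (q : ℕ) {C : ℝ}
    (h : ∀ j k, ‖entry x j k‖ * weight j k ^ (q + 2) ≤ C) :
    opNorm q x ≤ C * (invSqSum * √invSqSum) := by
  have hC : 0 ≤ C := (mul_nonneg (norm_nonneg _)
    (pow_nonneg (zero_le_one.trans (one_le_weight 0 0)) _)).trans (h 0 0)
  rw [opNorm_apply]
  refine csSup_le (Set.Nonempty.image _ ⟨0, zero_mem_slowBall q⟩) ?_
  rintro _ ⟨ξ, ⟨hξ, hξ1⟩, rfl⟩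
  change rapidNorm q (x.toCLM ξ) ≤ _
  rw [rapidNorm_apply, ← mul_assoc]
  refine (mem_hSpace_of_bound fun j => ?_).2
  have hj : (1 : ℝ) ≤ (j : ℝ) + 1 := by simp
  have hj0 : (0 : ℝ) < (j : ℝ) + 1 := by positivity
  have hb : ∀ k, ‖entry x j k‖ * ((k : ℝ) + 1) ^ (q + 2) ≤ C / ((j : ℝ) + 1) ^ (q + 2) := by
    intro k
    rw [le_div_iff₀ (by positivity)]
    refine le_of_eq_of_le ?_ (h j k)
    rw [weight, mul_pow]
    ring
  rw [← (hasSum_entry x ξ j).tsum_eq]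
  calc _ ≤ (C / ((j : ℝ) + 1) ^ (q + 2) * 1 * invSqSum) * ((j : ℝ) + 1) ^ (q + 2) := by
        refine mul_le_mul ((pairing_bound hb hξ).2.trans ?_)
          (pow_le_pow_right₀ hj (by lia)) (by positivity)
          (mul_nonneg (by positivity) invSqSum_nonneg)
        exact mul_le_mul_of_nonneg_right (mul_le_mul_of_nonneg_left hξ1 (by positivity))
          invSqSum_nonneg
    _ = _ := by field_simp

/-! ### The embedding into `L(ℓ²)` -/

theorem toL2_mul (x y : SmoothOp) : (x * y).toL2 = x.toL2 * y.toL2 := rfl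

theorem norm_toL2_le (x : SmoothOp) : ‖x.toL2‖ ≤ opNorm 0 x := by
  refine ContinuousLinearMap.opNorm_le_of_unit_norm (apply_nonneg _ _) fun ξ hξ => ?_
  have h : l2ToSlow ξ ∈ slowBall 0 := ⟨mem_hSpace_zero ξ, (hNorm_zero ξ).trans_le hξ.le⟩
  exact (norm_rapidToL2Lin _).trans_le (le_csSup (bddAbove_opNorm 0 x) ⟨_, h, rfl⟩)

/-- The embedding of `L(s', s)` into `L(ℓ²)` as a linear map. -/
def toL2Lin : SmoothOp →ₗ[ℂ] (L2 →L[ℂ] L2) where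
  toFun := SmoothOp.toL2
  map_add' _ _ := rfl
  map_smul' c x := ContinuousLinearMap.ext fun ξ => map_smul rapidToL2 c (x.toCLM (l2ToSlow ξ))

theorem toL2_add (x y : SmoothOp) : (x + y).toL2 = x.toL2 + y.toL2 := map_add toL2Lin x y
theorem toL2_sub (x y : SmoothOp) : (x - y).toL2 = x.toL2 - y.toL2 := map_sub toL2Lin x y
theorem toL2_smul (c : ℂ) (x : SmoothOp) : (c • x).toL2 = c • x.toL2 := map_smul toL2Lin c x
theorem toL2_zero : (0 : SmoothOp).toL2 = 0 := map_zero toL2Lin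
theorem toL2_sum {ι : Type*} (s : Finset ι) (x : ι → SmoothOp) :
    (∑ i ∈ s, x i).toL2 = ∑ i ∈ s, (x i).toL2 := map_sum toL2Lin x s

theorem toL2_eq_zero {x : SmoothOp} : x.toL2 = 0 ↔ x = 0 :=
  ⟨fun h => toL2_injective (h.trans toL2_zero.symm), fun h => h ▸ toL2_zero⟩

theorem continuous_toL2 : Continuous SmoothOp.toL2 := by
  refine smoothOp_withSeminorms.continuous_of_isBounded (norm_withSeminorms ℂ _) toL2Lin ?_
  intro _
  refine ⟨{0}, 1, fun x => ?_⟩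
  rw [Finset.sup_singleton, one_smul]
  exact norm_toL2_le x

theorem entry_sub (x y : SmoothOp) (j k : ℕ) : entry (x - y) j k = entry x j k - entry y j k := by
  rw [entry, toL2_sub]
  rfl

theorem entry_eq_inner (x : SmoothOp) (j k : ℕ) :
    entry x j k = inner ℂ (unitVec j) (x.toL2 (unitVec k)) := (inner_unitVec _ _).symm

theorem exists_toL2_eq (T : L2 →L[ℂ] L2)
    (h : IsRapidMatrix fun j k => inner ℂ (unitVec j) (T (unitVec k))) :
    ∃ x : SmoothOp, x.toL2 = T := by
  obtain ⟨x, hx⟩ := exists_entry_eq h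
  refine ⟨x, unitVec_ext fun j k => ?_⟩
  rw [← inner_unitVec j (T _)]
  exact congrFun (congrFun hx j) k

/-- Rapid decay is symmetric in j and k, hence preserved by the conjugate transpose. -/
theorem exists_star (x : SmoothOp) : ∃ y : SmoothOp, y.toL2 = star x.toL2 := by
  refine exists_toL2_eq _ fun q => ?_
  obtain ⟨C, hC⟩ := isRapidMatrix_entry x q
  refine ⟨C, fun j k => le_of_eq_of_le ?_ (hC k j)⟩
  rw [ContinuousLinearMap.star_eq_adjoint]
  beta_reduce
  rw [ContinuousLinearMap.adjoint_inner_right,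
    norm_inner_symm, entry_eq_inner, weight, weight, mul_comm ((j : ℝ) + 1)]

/-! ### Convergence in `L(s', s)` -/

/-- The matrices `a i` decrease rapidly, uniformly in `i`. -/
def UniformlyRapid {ι : Type*} (a : ι → ℕ → ℕ → ℂ) : Prop :=
  ∀ q : ℕ, ∃ C : ℝ, ∀ i j k, ‖a i j k‖ * weight j k ^ q ≤ C

/-- Geometric mean of a row bound and a column bound, each with exponent 2q. -/
theorem uniformlyRapid_of_rows_of_columns {ι : Type*} {a : ι → ℕ → ℕ → ℂ}
    (hr : ∀ q : ℕ, ∃ C : ℝ, ∀ i j k, ‖a i j k‖ * ((j : ℝ) + 1) ^ q ≤ C)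
    (hc : ∀ q : ℕ, ∃ C : ℝ, ∀ i j k, ‖a i j k‖ * ((k : ℝ) + 1) ^ q ≤ C) :
    UniformlyRapid a := by
  intro q
  obtain ⟨C, hC⟩ := hr (2 * q)
  obtain ⟨D, hD⟩ := hc (2 * q)
  refine ⟨√(C * D), fun i j k => Real.le_sqrt_of_sq_le ?_⟩
  calc (‖a i j k‖ * weight j k ^ q) ^ 2 =
        (‖a i j k‖ * ((j : ℝ) + 1) ^ (2 * q)) * (‖a i j k‖ * ((k : ℝ) + 1) ^ (2 * q)) := by
        rw [weight, mul_pow, mul_pow]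
        ring
    _ ≤ C * D := mul_le_mul (hC i j k) (hD i j k) (by positivity)
        ((by positivity : (0 : ℝ) ≤ _).trans (hC i j k))

/-- Outside a finite square of positions the uniform decay makes the weighted entries small; inside,
finitely many entries converge. -/
theorem tendsto_of_entry {x : ℕ → SmoothOp} {z : SmoothOp}
    (hb : UniformlyRapid fun n => entry (x n))
    (hl : ∀ j k, Tendsto (fun n => entry (x n) j k) atTop (𝓝 (entry z j k))) :
    Tendsto x atTop (𝓝 z) := by
  rw [smoothOp_withSeminorms.tendsto_nhds]
  intro q ε hε
  set K := invSqSum * √invSqSum with hK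
  have hK0 : 0 ≤ K := mul_nonneg invSqSum_nonneg (Real.sqrt_nonneg _)
  obtain ⟨δ, hδ, hδε⟩ : ∃ δ > 0, δ * K < ε := by
    refine ⟨ε / (K + 1), by positivity, ?_⟩
    rw [div_mul_eq_mul_div, div_lt_iff₀ (by positivity)]
    nlinarith
  -- This is one power more than `opNorm_le_of_entry` needs: the spare factor `weight j k ≥ R` makes
  -- the tail at most δ.
  obtain ⟨C, hC⟩ := hb (q + 3)
  obtain ⟨D, hD⟩ := isRapidMatrix_entry z (q + 3)
  obtain ⟨R, hR⟩ := exists_nat_ge ((C + D) / δ)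
  have hfin : ∀ᶠ n in atTop, ∀ j ∈ Finset.range R, ∀ k ∈ Finset.range R,
      ‖entry (x n - z) j k‖ * weight j k ^ (q + 2) ≤ δ := by
    rw [Finset.eventually_all]
    intro j _
    rw [Finset.eventually_all]
    intro k _
    have h1 : Tendsto (fun n => ‖entry (x n - z) j k‖ * weight j k ^ (q + 2)) atTop (𝓝 0) := by
      have := (((hl j k).sub_const (entry z j k)).norm).mul_const (weight j k ^ (q + 2))
      simpa [entry_sub] using this
    exact h1.eventually_le_const hδ
  filter_upwards [hfin] with n hn
  refine (opNorm_le_of_entry (x n - z) q fun j k => ?_).trans_lt hδε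
  by_cases hjk : j < R ∧ k < R
  · exact hn j (Finset.mem_range.2 hjk.1) k (Finset.mem_range.2 hjk.2)
  have hw := one_le_weight j k
  have hRw : (R : ℝ) ≤ weight j k := by
    have hj : (0 : ℝ) ≤ j := Nat.cast_nonneg j
    have hk : (0 : ℝ) ≤ k := Nat.cast_nonneg k
    rcases not_and_or.1 hjk with h | h
    · have : (R : ℝ) ≤ j := by exact_mod_cast not_lt.1 h
      rw [weight]
      nlinarith
    · have : (R : ℝ) ≤ k := by exact_mod_cast not_lt.1 h
      rw [weight]
      nlinarith
  have h1 : ‖entry (x n - z) j k‖ * weight j k ^ (q + 3) ≤ C + D := by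
    rw [entry_sub]
    calc _ ≤ (‖entry (x n) j k‖ + ‖entry z j k‖) * weight j k ^ (q + 3) := by
          gcongr
          exact norm_sub_le _ _
      _ ≤ C + D := by
          rw [add_mul]
          exact add_le_add (hC n j k) (hD j k)
  have h2 : C + D ≤ δ * weight j k := by
    rw [div_le_iff₀ hδ] at hR
    nlinarith
  have h3 : ‖entry (x n - z) j k‖ * weight j k ^ (q + 2) * weight j k ≤ δ * weight j k := by
    refine le_trans (le_of_eq ?_) (h1.trans h2)
    ring
  exact le_of_mul_le_mul_right h3 (by linarith)

theorem exists_tendsto_of_entry {x : ℕ → SmoothOp}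
    (hb : UniformlyRapid fun n => entry (x n))
    (hl : ∀ j k, ∃ l, Tendsto (fun n => entry (x n) j k) atTop (𝓝 l)) :
    ∃ z, Tendsto x atTop (𝓝 z) := by
  choose a ha using hl
  obtain ⟨z, hz⟩ : ∃ z : SmoothOp, entry z = a := by
    refine exists_entry_eq fun q => ?_
    obtain ⟨C, hC⟩ := hb q
    exact ⟨C, fun j k => le_of_tendsto ((ha j k).norm.mul_const _)
      (Eventually.of_forall fun n => hC n j k)⟩
  exact ⟨z, tendsto_of_entry hb fun j k => by rw [hz]; exact ha j k⟩

theorem exists_tendsto_inner_of_quadratic {T : ℕ → L2 →L[ℂ] L2}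
    (h : ∀ ξ, ∃ l, Tendsto (fun n => inner ℂ (T n ξ) ξ) atTop (𝓝 l)) (ξ η : L2) :
    ∃ l, Tendsto (fun n => inner ℂ (T n ξ) η) atTop (𝓝 l) := by
  choose l hl using h
  refine ⟨_, Tendsto.congr (fun n => (inner_map_polarization' (T n).toLinearMap ξ η).symm)
    (((((hl (ξ + η)).sub (hl (ξ - η))).sub ((hl (ξ + Complex.I • η)).const_mul Complex.I)).add
      ((hl (ξ - Complex.I • η)).const_mul Complex.I)).div_const 4)⟩

theorem exists_tendsto_entry_of_quadratic {x : ℕ → SmoothOp}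
    (h : ∀ ξ, ∃ l, Tendsto (fun n => inner ℂ ((x n).toL2 ξ) ξ) atTop (𝓝 l)) (j k : ℕ) :
    ∃ l, Tendsto (fun n => entry (x n) j k) atTop (𝓝 l) := by
  obtain ⟨l, hl⟩ := exists_tendsto_inner_of_quadratic h (unitVec k) (unitVec j)
  refine ⟨star l, hl.star.congr fun n => ?_⟩
  rw [entry_eq_inner]
  exact inner_conj_symm _ _

/-! ### Spectral projections -/

theorem norm_inner_mul_mul_le (x y : SmoothOp) (S T : L2 →L[ℂ] L2) (hS : ‖S‖ ≤ 1) (hT : ‖T‖ ≤ 1)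
    (j k : ℕ) : ‖inner ℂ (S (x.toL2 (unitVec j))) (T (y.toL2 (unitVec k)))‖ ≤
      ‖x.toL2 (unitVec j)‖ * ‖y.toL2 (unitVec k)‖ := by
  refine (norm_inner_le_norm _ _).trans (mul_le_mul ?_ ?_ (norm_nonneg _) (norm_nonneg _))
  · exact (S.le_of_opNorm_le hS _).trans_eq (one_mul _)
  · exact (T.le_of_opNorm_le hT _).trans_eq (one_mul _)

theorem inner_pow_of_isSelfAdjoint {Y : L2 →L[ℂ] L2} (hY : IsSelfAdjoint Y) (m n : ℕ) (ξ η : L2) :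
    inner ℂ ((Y ^ (m + n)) ξ) η = inner ℂ ((Y ^ n) ξ) ((Y ^ m) η) := by
  have h := (hY.pow m).adjoint_eq
  rw [pow_add, mul_apply_eq_comp]
  nth_rewrite 1 [← h]
  rw [ContinuousLinearMap.adjoint_inner_left]

/-- Q is the limit of the powers Y^(2m+2). Their entries are ⟨YⁿYe_j, YⁿYe_k⟩ with ‖Yⁿ‖ ≤ 1, so they
decay uniformly. Their quadratic forms are ‖Y^(n+1)ξ‖², which decrease, so the entries converge by
polarization. -/
theorem exists_spectral_projection_of_norm_eq_one (y : SmoothOp) (hy : IsSelfAdjoint y.toL2)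
    (hy1 : ‖y.toL2‖ = 1) : ∃ Q : SmoothOp, IsProjection Q ∧ Q ≠ 0 ∧ y * y * Q = Q ∧
      ∀ B : NonUnitalSubalgebra ℂ SmoothOp, IsClosed (B : Set SmoothOp) → y ∈ B → Q ∈ B := by
  set Y := y.toL2 with hYdef
  obtain ⟨x, hx, hxB⟩ : ∃ x : ℕ → SmoothOp, (∀ m, (x m).toL2 = Y ^ (2 * m + 2)) ∧
      ∀ B : NonUnitalSubalgebra ℂ SmoothOp, y ∈ B → ∀ m, x m ∈ B := by
    -- The algebra is not assumed to have a unit, so the recursion starts at y² instead of 1.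
    refine ⟨fun m => Nat.rec (y * y) (fun _ z => y * y * z) m, fun m => ?_, fun B hB m => ?_⟩
    · induction m with
      | zero => exact (sq Y).symm
      | succ m ih =>
        rw [toL2_mul, ih, toL2_mul, ← hYdef, ← sq, ← pow_add]
        congr 1
        ring
    · induction m with
      | zero => exact mul_mem hB hB
      | succ m ih => exact mul_mem (mul_mem hB hB) ih
  have hpow : ∀ m, ‖Y ^ m‖ ≤ 1 := fun m => by
    rcases Nat.eq_zero_or_pos m with rfl | hm
    · rw [pow_zero]
      exact ContinuousLinearMap.norm_id_le
    · exact (norm_pow_le' Y hm).trans_eq (by rw [hy1, one_pow])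
  have hb : UniformlyRapid fun n => entry (x n) := by
    have e : ∀ n j k, ‖entry (x n) j k‖ ≤ ‖Y (unitVec j)‖ * ‖Y (unitVec k)‖ := by
      intro n j k
      have : entry (x n) j k = inner ℂ ((Y ^ n) (Y (unitVec j))) ((Y ^ n) (Y (unitVec k))) := by
        rw [entry_eq_inner, hx, ← inner_conj_symm, show 2 * n + 2 = (n + 1) + (n + 1) by ring,
          inner_pow_of_isSelfAdjoint hy, inner_conj_symm, pow_succ]
        rfl
      rw [this]
      exact norm_inner_mul_mul_le y y _ _ (hpow n) (hpow n) j k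
    intro q
    obtain ⟨C, hC⟩ := norm_toL2_unitVec_bound y q
    refine ⟨C * C, fun n j k => ?_⟩
    calc _ ≤ ‖Y (unitVec j)‖ * ‖Y (unitVec k)‖ * weight j k ^ q :=
          mul_le_mul_of_nonneg_right (e n j k)
            (pow_nonneg (zero_le_one.trans (one_le_weight j k)) _)
      _ = (‖Y (unitVec j)‖ * ((j : ℝ) + 1) ^ q) * (‖Y (unitVec k)‖ * ((k : ℝ) + 1) ^ q) := by
          rw [weight, mul_pow]
          ring
      _ ≤ C * C := mul_le_mul (hC j) (hC k) (by positivity)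
          ((by positivity : (0 : ℝ) ≤ _).trans (hC j))
  have hquad : ∀ ξ, ∃ l, Tendsto (fun n => inner ℂ ((x n).toL2 ξ) ξ) atTop (𝓝 l) := by
    intro ξ
    have e : ∀ n, inner ℂ ((x n).toL2 ξ) ξ = ((‖(Y ^ (n + 1)) ξ‖ ^ 2 : ℝ) : ℂ) := by
      intro n
      rw [hx, show 2 * n + 2 = (n + 1) + (n + 1) by ring, inner_pow_of_isSelfAdjoint hy,
        inner_self_eq_norm_sq_to_K]
      norm_cast
    simp only [e]
    have hanti : Antitone fun n => ‖(Y ^ (n + 1)) ξ‖ ^ 2 := by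
      refine antitone_nat_of_succ_le fun n => pow_le_pow_left₀ (norm_nonneg _) ?_ 2
      rw [pow_succ' Y (n + 1)]
      exact (Y.le_of_opNorm_le hy1.le _).trans_eq (one_mul _)
    have hbdd : BddBelow (Set.range fun n => ‖(Y ^ (n + 1)) ξ‖ ^ 2) :=
      ⟨0, by rintro _ ⟨n, rfl⟩; positivity⟩
    exact ⟨_, (Complex.continuous_ofReal.tendsto _).comp (tendsto_atTop_ciInf hanti hbdd)⟩
  obtain ⟨Q, hQ⟩ := exists_tendsto_of_entry hb (exists_tendsto_entry_of_quadratic hquad)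
  have hR : Tendsto (fun n => Y ^ (2 * n + 2)) atTop (𝓝 Q.toL2) := by
    have := (continuous_toL2.tendsto Q).comp hQ
    exact this.congr hx
  refine ⟨Q, ⟨?_, ?_⟩, ?_, toL2_injective ?_, fun B hB hyB =>
    hB.mem_of_tendsto hQ (Eventually.of_forall fun m => hxB B hyB m)⟩
  · have h1 : Tendsto (fun n => Y ^ (2 * (2 * n + 1) + 2)) atTop (𝓝 Q.toL2) :=
      hR.comp (tendsto_atTop_mono (fun n => (by lia : n ≤ 2 * n + 1)) tendsto_id)
    refine tendsto_nhds_unique ((hR.mul hR).congr fun n => ?_) h1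
    rw [← pow_add]
    congr 1
    ring
  · exact tendsto_nhds_unique (hR.star.congr fun n => (hy.pow _).star_eq) hR
  · rintro rfl
    rw [toL2_zero] at hR
    have h1 := hR.norm
    rw [norm_zero] at h1
    obtain ⟨N, hN⟩ := eventually_atTop.1 (h1.eventually_lt_const one_pos)
    -- This index gives the exponent 2^(N+1), where self-adjointness yields ‖Y^(2^(N+1))‖ =
    -- ‖Y‖^(2^(N+1)) = 1; so the limit cannot be 0.
    have h2 := hN (2 ^ N - 1) (Nat.le_sub_one_of_lt Nat.lt_two_pow_self)
    have h3 : 2 * (2 ^ N - 1) + 2 = 2 ^ (N + 1) := by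
      have := Nat.one_le_two_pow (n := N)
      rw [pow_succ]
      lia
    rw [h3, hy.norm_pow_two_pow, hy1, one_pow] at h2
    exact lt_irrefl _ h2
  · have h1 : Tendsto (fun n => Y ^ (2 * (n + 1) + 2)) atTop (𝓝 Q.toL2) :=
      hR.comp (tendsto_add_atTop_nat 1)
    refine tendsto_nhds_unique ((hR.const_mul (Y * Y)).congr fun n => ?_) h1
    rw [← sq, ← pow_add]
    congr 1
    ring

/-- Rescale y to norm 1; the eigenvalue c is ‖y‖² in the operator norm of ℓ². -/
theorem exists_spectral_projection (y : SmoothOp) (hy : IsSelfAdjoint y.toL2) (hy0 : y ≠ 0) :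
    ∃ Q : SmoothOp, IsProjection Q ∧ Q ≠ 0 ∧ (∃ c : ℝ, 0 < c ∧ y * y * Q = (c : ℂ) • Q) ∧
      ∀ B : NonUnitalSubalgebra ℂ SmoothOp, IsClosed (B : Set SmoothOp) → y ∈ B → Q ∈ B := by
  set r := ‖y.toL2‖ with hr
  have hr0 : 0 < r := norm_pos_iff.2 fun h => hy0 (toL2_eq_zero.1 h)
  set c : ℂ := ((r⁻¹ : ℝ) : ℂ) with hc
  have h1 : IsSelfAdjoint (c • y).toL2 := by
    rw [toL2_smul]
    refine IsSelfAdjoint.smul ?_ hy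
    exact Complex.conj_ofReal _
  have h2 : ‖(c • y).toL2‖ = 1 := by
    rw [toL2_smul, norm_smul, hc, Complex.norm_real, Real.norm_of_nonneg (inv_nonneg.2 hr0.le),
      ← hr, inv_mul_cancel₀ hr0.ne']
  obtain ⟨Q, hQ, hQ0, hyQ, hB⟩ := exists_spectral_projection_of_norm_eq_one _ h1 h2
  refine ⟨Q, hQ, hQ0, ⟨r ^ 2, by positivity, ?_⟩, fun B hBc hyB =>
    hB B hBc (B.toSubmodule.smul_mem c hyB)⟩
  have hrc : ((r ^ 2 : ℝ) : ℂ) * (c * c) = 1 := by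
    rw [hc]
    norm_cast
    field_simp
  have e : c • y * c • y * Q = (c * c) • (y * y * Q) := by
    rw [smul_mul_assoc, mul_smul_comm, smul_smul, smul_mul_assoc]
  rw [← one_smul ℂ (y * y * Q), ← hrc, ← smul_smul, ← e, hyQ]

/-! ### Projections -/

theorem IsProjection.mul_self {P : SmoothOp} (hP : IsProjection P) : P * P = P :=
  toL2_injective hP.isIdempotentElem.eq

theorem IsProjection.inner_apply_self {P : SmoothOp} (hP : IsProjection P) (ξ : L2) :
    inner ℂ (P.toL2 ξ) ξ = ((‖P.toL2 ξ‖ ^ 2 : ℝ) : ℂ) := by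
  have h : P.toL2 (P.toL2 ξ) = P.toL2 ξ :=
    congrArg (fun T : L2 →L[ℂ] L2 => T ξ) hP.isIdempotentElem.eq
  have h1 := ContinuousLinearMap.adjoint_inner_left P.toL2 ξ (P.toL2 ξ)
  rw [hP.isSelfAdjoint.adjoint_eq, h, inner_self_eq_norm_sq_to_K] at h1
  rw [h1]
  norm_cast

theorem IsProjection.norm_apply_le {P : SmoothOp} (hP : IsProjection P) (ξ : L2) :
    ‖P.toL2 ξ‖ ≤ ‖ξ‖ :=
  (P.toL2.le_of_opNorm_le (IsStarProjection.norm_le _ hP) ξ).trans_eq (one_mul _)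

theorem IsProjection.mul {P Q : SmoothOp} (hP : IsProjection P) (hQ : IsProjection Q)
    (h : P * Q = Q * P) : IsProjection (P * Q) :=
  IsStarProjection.mul hP hQ (congrArg SmoothOp.toL2 h)

theorem IsProjection.sub {P Q : SmoothOp} (hP : IsProjection P) (hQ : IsProjection Q)
    (h : P * Q = P) : IsProjection (Q - P) := by
  rw [IsProjection, toL2_sub]
  exact IsStarProjection.sub_of_mul_eq_left hP hQ (congrArg SmoothOp.toL2 h)

theorem IsProjection.mul_eq_of_mul_eq {P Q : SmoothOp} (hP : IsProjection P) (hQ : IsProjection Q)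
    (h : P * Q = P) : Q * P = P := by
  have h1 := congrArg star (congrArg SmoothOp.toL2 h)
  rw [toL2_mul, star_mul, hP.isSelfAdjoint.star_eq, hQ.isSelfAdjoint.star_eq] at h1
  exact toL2_injective h1

theorem sum_smul_mul_of_orthogonal {ι : Type*} [DecidableEq ι] {P : ι → SmoothOp}
    (hP : ∀ i, IsProjection (P i)) (ho : ∀ i j, i ≠ j → P i * P j = 0) (c : ι → ℂ)
    (s : Finset ι) (k : ι) :
    (∑ i ∈ s, c i • P i) * P k = if k ∈ s then c k • P k else 0 := by
  rw [Finset.sum_mul, ← Finset.sum_ite_eq s k fun i => c i • P i]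
  refine Finset.sum_congr rfl fun i _ => ?_
  rw [smul_mul_assoc]
  split_ifs with h
  · rw [← h, (hP k).mul_self]
  · rw [ho i k (Ne.symm h), smul_zero]

theorem isProjection_sum {ι : Type*} {P : ι → SmoothOp} (hP : ∀ i, IsProjection (P i))
    (ho : ∀ i j, i ≠ j → P i * P j = 0) (s : Finset ι) : IsProjection (∑ i ∈ s, P i) := by
  classical
  induction s using Finset.induction_on with
  | empty =>
    rw [Finset.sum_empty, IsProjection, toL2_zero]
    exact IsStarProjection.zero _
  | insert a s ha ih =>
    rw [Finset.sum_insert ha, IsProjection, toL2_add]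
    refine IsStarProjection.add (hP a) ih ?_
    rw [← toL2_mul, Finset.mul_sum, Finset.sum_eq_zero, toL2_zero]
    exact fun i hi => ho a i fun h => ha (h ▸ hi)

theorem inner_sum_apply {ι : Type*} {P : ι → SmoothOp} (hP : ∀ i, IsProjection (P i))
    (s : Finset ι) (ξ : L2) :
    inner ℂ ((∑ i ∈ s, P i).toL2 ξ) ξ = ((∑ i ∈ s, ‖(P i).toL2 ξ‖ ^ 2 : ℝ) : ℂ) := by
  rw [toL2_sum, sum_apply, sum_inner, Complex.ofReal_sum]
  exact Finset.sum_congr rfl fun i _ => (hP i).inner_apply_self ξ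

/-- Bessel's inequality: finite sums of orthogonal projections are contractions. -/
theorem summable_norm_sq_apply {ι : Type*} {P : ι → SmoothOp} (hP : ∀ i, IsProjection (P i))
    (ho : ∀ i j, i ≠ j → P i * P j = 0) (ξ : L2) : Summable fun i => ‖(P i).toL2 ξ‖ ^ 2 := by
  refine summable_of_sum_le (c := ‖ξ‖ ^ 2) (fun i => by positivity) fun s => ?_
  have h1 := inner_sum_apply hP s ξ
  have h2 := isProjection_sum hP ho s
  rw [h2.inner_apply_self, Complex.ofReal_inj] at h1
  rw [← h1]
  exact pow_le_pow_left₀ (norm_nonneg _) (h2.norm_apply_le ξ) 2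

/-! ### The rank of a projection -/

theorem hasSum_norm_sq (ξ : L2) : HasSum (fun j => ‖(ξ : ℕ → ℂ) j‖ ^ 2) (‖ξ‖ ^ 2) := by
  have h : Summable fun j => ‖(ξ : ℕ → ℂ) j‖ ^ 2 * ((j : ℝ) + 1) ^ (2 * (0 : ℤ)) :=
    mem_hSpace_zero ξ
  have h1 := hNorm_zero ξ
  simp only [mul_zero, zpow_zero, mul_one, hNorm] at h h1
  rw [← h1, Real.sq_sqrt (tsum_nonneg fun _ => by positivity)]
  exact h.hasSum

/-- The trace of a projection `P`, as the squared Hilbert–Schmidt norm. -/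
def projTrace (P : SmoothOp) : ℝ := ∑' j, ‖P.toL2 (unitVec j)‖ ^ 2

theorem summable_projTrace (P : SmoothOp) : Summable fun j => ‖P.toL2 (unitVec j)‖ ^ 2 := by
  obtain ⟨C, hC⟩ := norm_toL2_unitVec_bound P 1
  refine Summable.of_nonneg_of_le (fun j => by positivity) (fun j => ?_)
    (summable_inv_sq.mul_left (C ^ 2))
  rw [mul_one_div, le_div_iff₀ (by positivity), ← mul_pow]
  exact pow_le_pow_left₀ (by positivity) (by simpa using hC j) 2

theorem projTrace_nonneg (P : SmoothOp) : 0 ≤ projTrace P := tsum_nonneg fun _ => by positivity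

/-- For a projection, ‖Pe‖² = ⟨Pe, e⟩ is linear in P. -/
theorem projTrace_sub {P Q : SmoothOp} (hP : IsProjection P) (hQ : IsProjection Q)
    (h : P * Q = P) : projTrace P + projTrace (Q - P) = projTrace Q := by
  rw [projTrace, projTrace, ← (summable_projTrace P).tsum_add (summable_projTrace (Q - P)),
    projTrace]
  refine tsum_congr fun j => ?_
  have h1 := (hP.sub hQ h).inner_apply_self (unitVec j)
  rw [toL2_sub, sub_apply, inner_sub_left, hP.inner_apply_self,
    hQ.inner_apply_self] at h1
  rw [toL2_sub, sub_apply]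
  have h2 : ‖Q.toL2 (unitVec j)‖ ^ 2 - ‖P.toL2 (unitVec j)‖ ^ 2 =
      ‖Q.toL2 (unitVec j) - P.toL2 (unitVec j)‖ ^ 2 := by exact_mod_cast h1
  linarith

theorem exists_fixed_ne_zero {P : SmoothOp} (hP : IsProjection P) (h0 : P ≠ 0) :
    ∃ f : L2, ‖f‖ = 1 ∧ P.toL2 f = f := by
  obtain ⟨ξ, hξ⟩ : ∃ ξ, P.toL2 ξ ≠ 0 := by
    by_contra! h
    exact h0 (toL2_eq_zero.1 (ContinuousLinearMap.ext h))
  have h : P.toL2 (P.toL2 ξ) = P.toL2 ξ :=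
    congrArg (fun T : L2 →L[ℂ] L2 => T ξ) hP.isIdempotentElem.eq
  refine ⟨((‖P.toL2 ξ‖⁻¹ : ℝ) : ℂ) • P.toL2 ξ, ?_, by rw [map_smul, h]⟩
  rw [norm_smul, Complex.norm_real, norm_inv, norm_norm,
    inv_mul_cancel₀ (norm_ne_zero_iff.2 hξ)]

/-- For a unit vector f in the range, f_j = ⟨Pe_j, f⟩, so |f_j| ≤ ‖Pe_j‖; sum the squares. -/
theorem one_le_projTrace {P : SmoothOp} (hP : IsProjection P) (h0 : P ≠ 0) : 1 ≤ projTrace P := by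
  obtain ⟨f, hf, hPf⟩ := exists_fixed_ne_zero hP h0
  have h1 := hasSum_norm_sq f
  rw [hf, one_pow] at h1
  rw [← h1.tsum_eq]
  refine h1.summable.tsum_le_tsum (fun j => ?_) (summable_projTrace P)
  have h2 : (f : ℕ → ℂ) j = inner ℂ (P.toL2 (unitVec j)) f := by
    have := ContinuousLinearMap.adjoint_inner_left P.toL2 f (unitVec j)
    rw [hP.isSelfAdjoint.adjoint_eq, hPf, inner_unitVec] at this
    exact this.symm
  rw [h2]
  refine pow_le_pow_left₀ (norm_nonneg _) ((norm_inner_le_norm _ _).trans_eq ?_) 2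
  rw [hf, mul_one]

/-! ### Minimal projections -/

variable {A : NonUnitalSubalgebra ℂ SmoothOp}

/-- A proper subprojection R of Q has trace smaller by that of Q − R, which is at least 1. Descent
therefore stops, by induction on an integer above the trace. -/
theorem exists_minimal_projection {Q : SmoothOp} (hQ : Q ∈ projections A) :
    ∃ P ∈ canonicalSchauderBasis A, P * Q = P := by
  obtain ⟨n, hn⟩ := exists_nat_gt (projTrace Q)
  induction n generalizing Q with
  | zero =>
    rw [Nat.cast_zero] at hn
    exact absurd (projTrace_nonneg Q) hn.not_ge
  | succ n ih =>
    by_cases hmin : Q ∈ canonicalSchauderBasis A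
    · exact ⟨Q, hmin, hQ.2.1.mul_self⟩
    obtain ⟨R, hR, hRQ, hne⟩ : ∃ R ∈ projections A, R * Q = R ∧ R ≠ Q := by
      by_contra! h
      exact hmin ⟨hQ, fun R hR h1 _ => h R hR h1⟩
    have h1 := projTrace_sub hR.2.1 hQ.2.1 hRQ
    have h2 := one_le_projTrace (hR.2.1.sub hQ.2.1 hRQ) (sub_ne_zero.2 hne.symm)
    obtain ⟨P, hP, hPR⟩ := ih hR (by push_cast at hn; linarith)
    exact ⟨P, hP, by rw [← hPR, mul_assoc, hRQ]⟩

/-- PQ is a projection in A below both; if nonzero, minimality makes it equal to each. -/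
theorem canonicalSchauderBasis_orthogonal (hA : IsClosedCommStarSubalgebra A) {P Q : SmoothOp}
    (hP : P ∈ canonicalSchauderBasis A) (hQ : Q ∈ canonicalSchauderBasis A) (h : P ≠ Q) :
    P * Q = 0 := by
  by_contra h0
  have hc : P * Q = Q * P := hA.comm P hP.1.1 Q hQ.1.1
  have hR : P * Q ∈ projections A := ⟨mul_mem hP.1.1 hQ.1.1, hP.1.2.1.mul hQ.1.2.1 hc, h0⟩
  have e1 : P * (P * Q) = P * Q := by rw [← mul_assoc, hP.1.2.1.mul_self]
  have e2 : P * Q * Q = P * Q := by rw [mul_assoc, hQ.1.2.1.mul_self]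
  have e3 : P * Q * P = P * Q := by rw [mul_assoc, ← hc, e1]
  have e4 : Q * (P * Q) = P * Q := by rw [← mul_assoc, ← hc, e2]
  exact h ((hP.2 _ hR e3 e1).symm.trans (hQ.2 _ hR e2 e4))

/-- By Bessel, each unit vector is moved to a nonzero vector by only countably many of the
projections, and every nonzero projection does this to some unit vector. -/
theorem canonicalSchauderBasis_countable (hA : IsClosedCommStarSubalgebra A) :
    (canonicalSchauderBasis A).Countable := by
  let P : canonicalSchauderBasis A → SmoothOp := Subtype.val
  have hs : ∀ j, (Function.support fun i => ‖(P i).toL2 (unitVec j)‖ ^ 2).Countable := fun j =>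
    (summable_norm_sq_apply (P := P) (fun i => i.2.1.2.1) (fun i k hik =>
      canonicalSchauderBasis_orthogonal hA i.2 k.2 fun h => hik (Subtype.ext h))
      (unitVec j)).countable_support
  rw [← Set.countable_coe_iff, ← Set.countable_univ_iff]
  refine (Set.countable_iUnion hs).mono fun i _ => ?_
  by_contra h
  simp only [Set.mem_iUnion, Function.mem_support, not_exists, not_not] at h
  refine i.2.1.2.2 (toL2_eq_zero.1 (unitVec_ext fun j k => ?_))
  have := h k
  rw [norm_eq_zero.1 (pow_eq_zero_iff two_ne_zero |>.1 this)]
  rfl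

/-- Here v plays the role of w*. The self-adjoint element w*w is nonzero by the C*-identity, so it
has a spectral projection. -/
theorem exists_projection_of_ne_zero {w v : SmoothOp} (hv : v.toL2 = star w.toL2) (hw : w ≠ 0) :
    ∃ Q : SmoothOp, IsProjection Q ∧ Q ≠ 0 ∧
      (∃ c : ℝ, 0 < c ∧ v * w * (v * w) * Q = (c : ℂ) • Q) ∧
      ∀ B : NonUnitalSubalgebra ℂ SmoothOp, IsClosed (B : Set SmoothOp) → v ∈ B → w ∈ B →
        Q ∈ B := by
  have e : (v * w).toL2 = star w.toL2 * w.toL2 := by rw [toL2_mul, hv]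
  obtain ⟨Q, hQ, hQ0, hc, hB⟩ := exists_spectral_projection (v * w)
    (by rw [e]; exact IsSelfAdjoint.star_mul_self _)
    (fun h => hw (toL2_eq_zero.1 ((CStarRing.star_mul_self_eq_zero_iff _).1
      (e.symm.trans (toL2_eq_zero.2 h)))))
  exact ⟨Q, hQ, hQ0, hc, fun B hBc h1 h2 => hB B hBc (mul_mem h1 h2)⟩

/-- If w ≠ 0, choose a minimal P below a spectral projection of w*w: then (w*w)²P is a nonzero
multiple of P, although wP = 0. -/
theorem eq_zero_of_mul_canonicalSchauderBasis (hA : IsClosedCommStarSubalgebra A) {w : SmoothOp}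
    (hw : w ∈ A) (h : ∀ P ∈ canonicalSchauderBasis A, w * P = 0) : w = 0 := by
  by_contra h0
  obtain ⟨v, hvA, hv⟩ := hA.star_mem w hw
  obtain ⟨Q, hQ, hQ0, ⟨c, hc, hcQ⟩, hB⟩ := exists_projection_of_ne_zero hv h0
  have hQA := hB A hA.isClosed hvA hw
  obtain ⟨P, hP, hPQ⟩ := exists_minimal_projection ⟨hQA, hQ, hQ0⟩
  have hQP := hP.1.2.1.mul_eq_of_mul_eq hQ hPQ
  have h1 : v * w * (v * w) * Q * P = 0 := by
    rw [mul_assoc _ Q, hQP, ← mul_assoc, mul_assoc _ w, h P hP, mul_zero]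
  rw [hcQ, smul_mul_assoc, hQP] at h1
  rcases smul_eq_zero.1 h1 with h2 | h2
  · exact hc.ne' (by exact_mod_cast h2)
  · exact hP.1.2.2 h2

/-- Since y = Py, the spectral projection Q of y lies below P, so Q = P by minimality and y² = y²P =
cP. -/
theorem exists_sq_eq_smul (hA : IsClosedCommStarSubalgebra A) {P y : SmoothOp}
    (hP : P ∈ canonicalSchauderBasis A) (hy : y ∈ A) (hs : IsSelfAdjoint y.toL2)
    (hyP : y * P = y) : ∃ c : ℝ, 0 ≤ c ∧ y * y = (c : ℂ) • P := by
  by_cases h0 : y = 0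
  · exact ⟨0, le_rfl, by simp [h0]⟩
  obtain ⟨Q, hQ, hQ0, ⟨c, hc, hcQ⟩, hB⟩ := exists_spectral_projection y hs h0
  have hQA := hB A hA.isClosed hy
  have hc0 : (c : ℂ) ≠ 0 := by exact_mod_cast hc.ne'
  have hPQ : P * Q = Q := by
    have h1 : (c : ℂ) • (P * Q) = (c : ℂ) • Q := by
      rw [← mul_smul_comm, ← hcQ, ← mul_assoc, ← mul_assoc, hA.comm P hP.1.1 y hy, hyP]
    exact (smul_right_injective _ hc0) h1
  have hQP : Q * P = Q := by rw [hA.comm Q hQA P hP.1.1, hPQ]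
  have hQeq := hP.2 Q ⟨hQA, hQ, hQ0⟩ hQP hPQ
  refine ⟨c, hc.le, ?_⟩
  rw [hQeq, mul_assoc, hyP] at hcQ
  exact hcQ

/-- Both y² = cP and (y − √c P)² = dP are multiples of P; expanding the second isolates 2√c y. -/
theorem exists_eq_smul_of_isSelfAdjoint (hA : IsClosedCommStarSubalgebra A) {P y : SmoothOp}
    (hP : P ∈ canonicalSchauderBasis A) (hy : y ∈ A) (hs : IsSelfAdjoint y.toL2)
    (hyP : y * P = y) : ∃ c : ℂ, y = c • P := by
  obtain ⟨c, hc, hyc⟩ := exists_sq_eq_smul hA hP hy hs hyP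
  rcases hc.eq_or_lt with rfl | hc
  · refine ⟨0, ?_⟩
    rw [zero_smul, ← toL2_eq_zero, ← CStarRing.star_mul_self_eq_zero_iff, hs.star_eq, ← toL2_mul,
      hyc, Complex.ofReal_zero, zero_smul, toL2_zero]
  set r : ℂ := ((√c : ℝ) : ℂ) with hr
  have hr2 : r * r = c := by
    rw [hr, ← Complex.ofReal_mul, Real.mul_self_sqrt hc.le]
  have hr0 : r ≠ 0 := by
    rw [hr]
    exact_mod_cast (Real.sqrt_pos.2 hc).ne'
  have hPy : P * y = y := by rw [hA.comm P hP.1.1 y hy, hyP]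
  have hPP := hP.1.2.1.mul_self
  obtain ⟨d, -, hd⟩ := exists_sq_eq_smul hA hP
    (sub_mem hy (A.toSubmodule.smul_mem r hP.1.1) : y - r • P ∈ A)
    (by
      rw [toL2_sub, toL2_smul]
      exact hs.sub (IsSelfAdjoint.smul (Complex.conj_ofReal _) hP.1.2.1.isSelfAdjoint))
    (by rw [sub_mul, smul_mul_assoc, hPP, hyP])
  rw [sub_mul, mul_sub, mul_sub, smul_mul_assoc, smul_mul_assoc, mul_smul_comm, mul_smul_comm,
    hPP, hyP, hPy, hyc, smul_smul, hr2] at hd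
  refine ⟨(2 * r)⁻¹ * (2 * c - d), ?_⟩
  have h2 : (2 * r) • y = (2 * (c : ℂ) - d) • P := by
    linear_combination (norm := module) (-1 : ℂ) • hd
  rw [← smul_smul, ← h2, smul_smul, inv_mul_cancel₀ (by simp [hr0]), one_smul]

/-- The self-adjoint elements x + x* and i(x − x*) reduce this to the self-adjoint case. -/
theorem exists_mul_eq_smul (hA : IsClosedCommStarSubalgebra A) {P x : SmoothOp}
    (hP : P ∈ canonicalSchauderBasis A) (hx : x ∈ A) : ∃ c : ℂ, x * P = c • P := by
  have key : ∀ a ∈ A, IsSelfAdjoint a.toL2 → ∃ c : ℂ, a * P = c • P := by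
    intro a ha hs
    refine exists_eq_smul_of_isSelfAdjoint hA hP (mul_mem ha hP.1.1) ?_
      (by rw [mul_assoc, hP.1.2.1.mul_self])
    exact (IsSelfAdjoint.commute_iff hs hP.1.2.1.isSelfAdjoint).1
      (congrArg SmoothOp.toL2 (hA.comm a ha P hP.1.1))
  obtain ⟨v, hvA, hv⟩ := hA.star_mem x hx
  rw [← ContinuousLinearMap.star_eq_adjoint] at hv
  obtain ⟨c, hc⟩ := key (x + v) (add_mem hx hvA) (by
    rw [toL2_add, hv]
    exact IsSelfAdjoint.add_star_self _)
  obtain ⟨d, hd⟩ := key (Complex.I • (x - v))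
    (A.toSubmodule.smul_mem _ (sub_mem hx hvA : x - v ∈ A)) (by
      rw [IsSelfAdjoint, toL2_smul, toL2_sub, hv, star_smul, star_sub, star_star,
        ← neg_sub (star x.toL2), smul_neg, ← neg_smul]
      simp)
  refine ⟨(c - Complex.I * d) / 2, ?_⟩
  rw [add_mul] at hc
  rw [smul_mul_assoc, sub_mul] at hd
  have hI : Complex.I * Complex.I = -1 := Complex.I_mul_I
  have h1 := congrArg (fun z => -Complex.I • z) hd
  simp only [smul_smul, neg_mul, hI, neg_neg, one_smul] at h1
  have h2 : (2 : ℂ) • (x * P) = (c - Complex.I * d) • P := by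
    linear_combination (norm := module) hc + h1
  rw [div_eq_inv_mul, ← smul_smul, ← h2, smul_smul, inv_mul_cancel₀ two_ne_zero, one_smul]

/-! ### The canonical Schauder basis -/

/-- With Sₙ the sum of the first n projections, the partial sums are Sₙx = xSₙ. The first form
bounds columns by ‖xe_k‖, the second bounds rows by ‖x*e_j‖. Entries converge because the quadratic
forms of Sₙ do, by Bessel. -/
theorem exists_tendsto_sum_smul {x : SmoothOp} {P : ℕ → SmoothOp} {c : ℕ → ℂ}
    (hP : ∀ n, IsProjection (P n)) (ho : ∀ m n, m ≠ n → P m * P n = 0)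
    (hxP : ∀ n, x * P n = c n • P n) (hPx : ∀ n, P n * x = c n • P n) :
    ∃ z, Tendsto (fun n => ∑ i ∈ Finset.range n, c i • P i) atTop (𝓝 z) := by
  set S : ℕ → SmoothOp := fun n => ∑ i ∈ Finset.range n, P i with hS
  have hSP : ∀ n, IsProjection (S n) := fun n => isProjection_sum hP ho _
  have hS1 : ∀ n, ∑ i ∈ Finset.range n, c i • P i = S n * x := fun n => by
    simp only [hS, Finset.sum_mul, hPx]
  have hS2 : ∀ n, ∑ i ∈ Finset.range n, c i • P i = x * S n := fun n => by
    simp only [hS, Finset.mul_sum, hxP]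
  obtain ⟨v, hv⟩ := exists_star x
  refine exists_tendsto_of_entry (uniformlyRapid_of_rows_of_columns ?_ ?_) fun j k => ?_
  · intro q
    obtain ⟨C, hC⟩ := norm_toL2_unitVec_bound v q
    refine ⟨C, fun n j k => (mul_le_mul_of_nonneg_right ?_ (by positivity)).trans (hC j)⟩
    rw [entry_eq_inner, hS2, toL2_mul, mul_apply_eq_comp, ← ContinuousLinearMap.adjoint_inner_left,
      ← ContinuousLinearMap.star_eq_adjoint, ← hv]
    refine (norm_inner_le_norm _ _).trans ?_
    refine mul_le_of_le_one_right (norm_nonneg _) (((hSP n).norm_apply_le _).trans_eq ?_)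
    exact norm_unitVec k
  · intro q
    obtain ⟨C, hC⟩ := norm_toL2_unitVec_bound x q
    refine ⟨C, fun n j k => (mul_le_mul_of_nonneg_right ?_ (by positivity)).trans (hC k)⟩
    rw [entry_eq_inner, hS1, toL2_mul, mul_apply_eq_comp]
    refine (norm_inner_le_norm _ _).trans ?_
    rw [norm_unitVec, one_mul]
    exact (hSP n).norm_apply_le _
  · obtain ⟨l, hl⟩ := exists_tendsto_inner_of_quadratic (T := fun n => (S n).toL2)
      (fun ξ => ⟨_, by
        simp only [hS, inner_sum_apply hP]
        exact (Complex.continuous_ofReal.tendsto _).comp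
          (summable_norm_sq_apply hP ho ξ).hasSum.tendsto_sum_nat⟩)
      (x.toL2 (unitVec k)) (unitVec j)
    refine ⟨star l, hl.star.congr fun n => ?_⟩
    rw [entry_eq_inner, hS1]
    exact inner_conj_symm _ _

theorem mul_eq_smul_of_tendsto {z : SmoothOp} {P : ℕ → SmoothOp} {c : ℕ → ℂ}
    (hP : ∀ n, IsProjection (P n)) (ho : ∀ m n, m ≠ n → P m * P n = 0)
    (hz : Tendsto (fun n => ∑ i ∈ Finset.range n, c i • P i) atTop (𝓝 z)) (k : ℕ) :
    z * P k = c k • P k := by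
  refine toL2_injective ?_
  have h := ((continuous_toL2.tendsto z).comp hz).mul_const (P k).toL2
  refine tendsto_nhds_unique h (tendsto_const_nhds.congr' ?_)
  filter_upwards [eventually_gt_atTop k] with n hn
  rw [Function.comp_apply, ← toL2_mul, sum_smul_mul_of_orthogonal hP ho,
    if_pos (Finset.mem_range.2 hn)]

/-- Multiplying an expansion by P_k forces its k-th coefficient. Conversely, the series with these
coefficients has its sum in A and differs from x by an element that every minimal projection kills.
-/
theorem isSchauderBasis_canonicalSchauderBasis (hA : IsClosedCommStarSubalgebra A) :
    IsSchauderBasis (canonicalSchauderBasis A) A.toSubmodule := by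
  refine ⟨fun P hP => hP.1.1, canonicalSchauderBasis_countable hA, ?_, ?_⟩
  · intro n P hinj hrange x hx
    have hmem : ∀ i, P i ∈ canonicalSchauderBasis A := fun i => hrange ▸ ⟨i, rfl⟩
    have hP : ∀ i, IsProjection (P i) := fun i => (hmem i).1.2.1
    have ho : ∀ i j, i ≠ j → P i * P j = 0 := fun i j hij =>
      canonicalSchauderBasis_orthogonal hA (hmem i) (hmem j) (hinj.ne hij)
    choose c hc using fun i => exists_mul_eq_smul hA (hmem i) hx
    refine ⟨c, ?_, fun d hd => funext fun k => ?_⟩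
    · have hsum : ∑ i, c i • P i ∈ A :=
        sum_mem fun i _ => A.toSubmodule.smul_mem _ (hmem i).1.1
      refine (sub_eq_zero.1 (eq_zero_of_mul_canonicalSchauderBasis hA (sub_mem hx hsum) ?_)).symm
      rw [← hrange]
      rintro _ ⟨k, rfl⟩
      rw [sub_mul, hc, sum_smul_mul_of_orthogonal hP ho, if_pos (Finset.mem_univ k), sub_self]
    · have h1 := hc k
      rw [← hd, sum_smul_mul_of_orthogonal hP ho, if_pos (Finset.mem_univ k)] at h1
      exact smul_left_injective ℂ (hmem k).1.2.2 h1
  · intro P hinj hrange x hx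
    have hmem : ∀ i, P i ∈ canonicalSchauderBasis A := fun i => hrange ▸ ⟨i, rfl⟩
    have hP : ∀ i, IsProjection (P i) := fun i => (hmem i).1.2.1
    have ho : ∀ i j, i ≠ j → P i * P j = 0 := fun i j hij =>
      canonicalSchauderBasis_orthogonal hA (hmem i) (hmem j) (hinj.ne hij)
    choose c hc using fun i => exists_mul_eq_smul hA (hmem i) hx
    refine ⟨c, ?_, fun d hd => funext fun k => ?_⟩
    · obtain ⟨z, hz⟩ := exists_tendsto_sum_smul hP ho hc fun n => by
        rw [hA.comm _ (hmem n).1.1 x hx, hc]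
      have hzA : z ∈ A := hA.isClosed.mem_of_tendsto hz (Eventually.of_forall fun n =>
        sum_mem fun i _ => A.toSubmodule.smul_mem _ (hmem i).1.1)
      have hxz : x = z := by
        refine sub_eq_zero.1 (eq_zero_of_mul_canonicalSchauderBasis hA (sub_mem hx hzA) ?_)
        rw [← hrange]
        rintro _ ⟨k, rfl⟩
        rw [sub_mul, hc, mul_eq_smul_of_tendsto hP ho hz, sub_self]
      rwa [hxz]
    · have h1 := hc k
      rw [mul_eq_smul_of_tendsto hP ho hd] at h1
      exact smul_left_injective ℂ (hmem k).1.2.2 h1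

/-! ### One-dimensional projections -/

theorem exists_toL2_eq_rankOne (g : RapidSeq) :
    ∃ F : SmoothOp, F.toL2 = InnerProductSpace.rankOne ℂ (rapidToL2 g) (rapidToL2 g) := by
  refine exists_toL2_eq _ fun q => ?_
  have hb : ∀ j, ‖g.val j‖ * ((j : ℝ) + 1) ^ q ≤ hNorm q g.val := fun j => by
    simpa using norm_mul_le_hNorm (g.mem q) j
  refine ⟨hNorm q g.val * hNorm q g.val, fun j k => ?_⟩
  have e : ‖(inner ℂ (unitVec j) (InnerProductSpace.rankOne ℂ (rapidToL2 g) (rapidToL2 g)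
      (unitVec k)) : ℂ)‖ = ‖g.val k‖ * ‖g.val j‖ := by
    rw [InnerProductSpace.rankOne_apply, inner_smul_right, norm_mul, norm_inner_symm,
      inner_unitVec, inner_unitVec]
    rfl
  rw [e]
  calc _ = (‖g.val j‖ * ((j : ℝ) + 1) ^ q) * (‖g.val k‖ * ((k : ℝ) + 1) ^ q) := by
        rw [weight, mul_pow]
        ring
    _ ≤ _ := mul_le_mul (hb j) (hb k) (by positivity) (hNorm_nonneg _ _)

theorem exists_rankOne_projection {g : RapidSeq} (hg : ‖rapidToL2 g‖ = 1) :
    ∃ F : SmoothOp, IsProjection F ∧ F ≠ 0 ∧ IsOneDimensional F ∧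
      F.toL2 = InnerProductSpace.rankOne ℂ (rapidToL2 g) (rapidToL2 g) := by
  obtain ⟨F, hF⟩ := exists_toL2_eq_rankOne g
  have hfix : F.toL2 (rapidToL2 g) = rapidToL2 g := by
    rw [hF, InnerProductSpace.rankOne_apply, inner_self_eq_norm_sq_to_K, hg]
    simp
  have hg0 : rapidToL2 g ≠ 0 := norm_ne_zero_iff.1 (by rw [hg]; exact one_ne_zero)
  refine ⟨F, ?_, ?_, ?_, hF⟩
  · rw [IsProjection, hF]
    exact InnerProductSpace.isStarProjection_rankOne_self hg
  · rintro rfl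
    rw [toL2_zero] at hfix
    exact hg0 hfix.symm
  · have hr : LinearMap.range F.toL2.toLinearMap = Submodule.span ℂ {rapidToL2 g} := by
      refine le_antisymm ?_ ?_
      · rintro _ ⟨ξ, rfl⟩
        change F.toL2 ξ ∈ _
        rw [hF, InnerProductSpace.rankOne_apply]
        exact Submodule.smul_mem _ _ (Submodule.mem_span_singleton_self _)
      · rw [Submodule.span_singleton_le_iff_mem]
        exact ⟨_, hfix⟩
    rw [IsOneDimensional, hr]
    exact finrank_span_singleton hg0

/-- The scalar c is the one by which Px acts on a vector spanning the range of P. -/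
theorem IsOneDimensional.exists_mul_mul_eq_smul {P : SmoothOp} (h1 : IsOneDimensional P)
    (x : SmoothOp) : ∃ c : ℂ, P * x * P = c • P := by
  obtain ⟨⟨v, ξ₀, hξ₀⟩, -, hv⟩ := finrank_eq_one_iff'.1 h1
  have hspan : ∀ ξ, ∃ a : ℂ, a • v = P.toL2 ξ := fun ξ => by
    obtain ⟨a, ha⟩ := hv ⟨_, ξ, rfl⟩
    exact ⟨a, congrArg Subtype.val ha⟩
  obtain ⟨c, hc⟩ := hspan (x.toL2 v)
  refine ⟨c, toL2_injective (ContinuousLinearMap.ext fun ξ => ?_)⟩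
  obtain ⟨a, ha⟩ := hspan ξ
  rw [toL2_mul, toL2_mul, mul_apply_eq_comp, mul_apply_eq_comp, ← ha, map_smul, map_smul, ← hc,
    toL2_smul, smul_apply, ← ha, smul_comm]

/-! ### Maximal commutative subalgebras -/

/-- A + ℂF is again a commutative *-subalgebra, and it is closed as the sum of a closed and a
finite-dimensional subspace. -/
theorem mem_of_isMaximalCommutative (hA : IsMaximalCommutative A) {F : SmoothOp}
    (hF : IsProjection F) (h : ∀ x ∈ A, ∃ c : ℂ, x * F = c • F ∧ F * x = c • F) : F ∈ A := by
  have hFF := hF.mul_self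
  have hmem : ∀ z, z ∈ A.toSubmodule ⊔ Submodule.span ℂ {F} ↔ ∃ a ∈ A, ∃ c : ℂ, a + c • F = z := by
    intro z
    simp only [Submodule.mem_sup, Submodule.mem_span_singleton, exists_exists_eq_and]
    rfl
  let B : NonUnitalSubalgebra ℂ SmoothOp :=
    { A.toSubmodule ⊔ Submodule.span ℂ {F} with
      mul_mem' := by
        intro x y hx hy
        obtain ⟨a, ha, c, rfl⟩ := (hmem x).1 hx
        obtain ⟨b, hb, d, rfl⟩ := (hmem y).1 hy
        obtain ⟨r, hr, -⟩ := h a ha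
        obtain ⟨s, -, hs⟩ := h b hb
        refine (hmem _).2 ⟨a * b, mul_mem ha hb, d * r + c * s + c * d, ?_⟩
        rw [add_mul, mul_add, mul_add, mul_smul_comm, smul_mul_assoc, smul_mul_assoc,
          mul_smul_comm, hr, hs, hFF]
        module }
  have hB : ∀ z, z ∈ B ↔ ∃ a ∈ A, ∃ c : ℂ, a + c • F = z := hmem
  have hAB : A ≤ B := fun a ha => (hB a).2 ⟨a, ha, 0, by simp⟩
  have hBc : IsClosedCommStarSubalgebra B := by
    refine ⟨Submodule.isClosed_sup_finiteDimensional A.toSubmodule (Submodule.span ℂ {F})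
      hA.prop.isClosed, fun x hx y hy => ?_, fun x hx => ?_⟩
    · obtain ⟨a, ha, c, rfl⟩ := (hB x).1 hx
      obtain ⟨b, hb, d, rfl⟩ := (hB y).1 hy
      obtain ⟨r, hr, hr'⟩ := h a ha
      obtain ⟨s, hs, hs'⟩ := h b hb
      simp only [add_mul, mul_add, mul_smul_comm, smul_mul_assoc, hr, hr', hs, hs', hFF,
        hA.prop.comm a ha b hb]
      module
    · obtain ⟨a, ha, c, rfl⟩ := (hB x).1 hx
      obtain ⟨b, hb, hab⟩ := hA.prop.star_mem a ha
      refine ⟨b + star c • F, (hB _).2 ⟨b, hb, _, rfl⟩, ?_⟩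
      rw [← ContinuousLinearMap.star_eq_adjoint] at hab ⊢
      rw [toL2_add, toL2_add, toL2_smul, toL2_smul, star_add, star_smul, hab,
        hF.isSelfAdjoint.star_eq]
  exact hA.le_of_ge hBc hAB ((hB F).2 ⟨0, zero_mem A, 1, by simp⟩)

/-- Otherwise Q could be adjoined with all scalars 0, so Q ∈ A, and a minimal P below Q would
satisfy P = PQ = 0. -/
theorem eq_zero_of_isMaximalCommutative (hA : IsMaximalCommutative A) {Q : SmoothOp}
    (hQ : IsProjection Q) (h : ∀ x ∈ A, x * Q = 0) : Q = 0 := by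
  by_contra h0
  have hQA : Q ∈ A := by
    refine mem_of_isMaximalCommutative hA hQ fun x hx => ⟨0, ?_, ?_⟩
    · rw [h x hx, zero_smul]
    · obtain ⟨v, hvA, hv⟩ := hA.prop.star_mem x hx
      have h1 := congrArg star (congrArg SmoothOp.toL2 (h v hvA))
      rw [toL2_mul, star_mul, hQ.isSelfAdjoint.star_eq, hv,
        ← ContinuousLinearMap.star_eq_adjoint, star_star, toL2_zero, star_zero, ← toL2_mul] at h1
      rw [toL2_eq_zero.1 h1, zero_smul]
  obtain ⟨P, hP, hPQ⟩ := exists_minimal_projection ⟨hQA, hQ, h0⟩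
  exact hP.1.2.2 (hPQ.symm.trans (h P hP.1.1))

/-- For a unit vector f in the range of P, the rank-one projection F onto ℂf satisfies xF = xPF =
cF; so F ∈ A, and F = P by minimality. -/
theorem isOneDimensional_of_isMaximalCommutative (hA : IsMaximalCommutative A) {P : SmoothOp}
    (hP : P ∈ canonicalSchauderBasis A) : IsOneDimensional P := by
  obtain ⟨f, hf, hPf⟩ := exists_fixed_ne_zero hP.1.2.1 hP.1.2.2
  -- As a fixed vector of P, f belongs to s; this is what puts the rank-one projection in L(s',s).
  have hfg : rapidToL2 (P.toCLM (l2ToSlow f)) = f := hPf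
  obtain ⟨F, hF, hF0, hF1, hFeq⟩ := exists_rankOne_projection (g := P.toCLM (l2ToSlow f))
    (by rw [hfg, hf])
  rw [hfg] at hFeq
  have hPF : P * F = F := toL2_injective <| ContinuousLinearMap.ext fun ξ => by
    rw [toL2_mul, mul_apply_eq_comp, hFeq, InnerProductSpace.rankOne_apply, map_smul, hPf]
  have hFP : F * P = F := by
    have h1 := congrArg star (congrArg SmoothOp.toL2 hPF)
    rw [toL2_mul, star_mul, hF.isSelfAdjoint.star_eq, hP.1.2.1.isSelfAdjoint.star_eq] at h1
    exact toL2_injective h1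
  have hFA : F ∈ A := by
    refine mem_of_isMaximalCommutative hA hF fun x hx => ?_
    obtain ⟨c, hc⟩ := exists_mul_eq_smul hA.prop hP hx
    refine ⟨c, ?_, ?_⟩
    · rw [← hPF, ← mul_assoc, hc, smul_mul_assoc]
    · nth_rewrite 1 [← hFP]
      rw [mul_assoc, hA.prop.comm P hP.1.1 x hx, hc, mul_smul_comm, hFP]
  rwa [← hP.2 F ⟨hFA, hF, hF0⟩ hFP hPF]

/-- The identity of ℓ² is not in L(s',s): columns must decay. -/
theorem exists_toL2_unitVec_ne (S : SmoothOp) : ∃ j, S.toL2 (unitVec j) ≠ unitVec j := by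
  by_contra! h
  obtain ⟨C, hC⟩ := norm_toL2_unitVec_bound S 1
  obtain ⟨n, hn⟩ := exists_nat_gt C
  have h1 := hC n
  rw [h, norm_unitVec, one_mul, pow_one] at h1
  linarith

/-- If there were finitely many, their sum S would be a unit of A. Some e_j − Se_j is a nonzero
vector of s, and the rank-one projection onto it would be annihilated by A. -/
theorem infinite_canonicalSchauderBasis (hA : IsMaximalCommutative A) :
    (canonicalSchauderBasis A).Infinite := by
  classical
  intro hfin
  have := hfin.fintype
  let P : canonicalSchauderBasis A → SmoothOp := Subtype.val
  have hP : ∀ i, IsProjection (P i) := fun i => i.2.1.2.1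
  have ho : ∀ i j, i ≠ j → P i * P j = 0 := fun i j hij =>
    canonicalSchauderBasis_orthogonal hA.prop i.2 j.2 fun h => hij (Subtype.ext h)
  set S : SmoothOp := ∑ i, P i with hS
  have hSA : S ∈ A := sum_mem fun i _ => i.2.1.1
  have hSP : IsProjection S := isProjection_sum hP ho _
  obtain ⟨j, hj⟩ := exists_toL2_unitVec_ne S
  let e : RapidSeq := ⟨unitVec j, fun q => (hSpace_unitVec q j).1⟩
  have he : rapidToL2 e = unitVec j := rfl
  let g₀ : RapidSeq := e - S.toCLM (l2ToSlow (unitVec j))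
  have hg₀ : rapidToL2 g₀ = unitVec j - S.toL2 (unitVec j) := map_sub rapidToL2 _ _
  have hne : ‖rapidToL2 g₀‖ ≠ 0 := by
    rw [hg₀, norm_ne_zero_iff]
    exact sub_ne_zero.2 hj.symm
  have hSg₀ : S.toL2 (rapidToL2 g₀) = 0 := by
    have h2 : S.toL2 (S.toL2 (unitVec j)) = S.toL2 (unitVec j) :=
      congrArg (fun T : L2 →L[ℂ] L2 => T (unitVec j)) hSP.isIdempotentElem.eq
    rw [hg₀, map_sub, h2, sub_self]
  obtain ⟨F, hF, hF0, -, hFeq⟩ := exists_rankOne_projection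
    (g := ((‖rapidToL2 g₀‖⁻¹ : ℝ) : ℂ) • g₀) (by
      rw [map_smul, norm_smul, Complex.norm_real, norm_inv, norm_norm, inv_mul_cancel₀ hne])
  have hSF : S * F = 0 := toL2_eq_zero.1 <| ContinuousLinearMap.ext fun ξ => by
    rw [toL2_mul, mul_apply_eq_comp, hFeq, InnerProductSpace.rankOne_apply, map_smul, map_smul,
      map_smul, hSg₀, smul_zero, smul_zero]
    rfl
  refine hF0 (eq_zero_of_isMaximalCommutative hA hF fun x hx => ?_)
  -- S is a unit of A: x − xS lies in A and is killed by every minimal projection.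
  have hxS : x - x * S = 0 := by
    refine eq_zero_of_mul_canonicalSchauderBasis hA.prop (sub_mem hx (mul_mem hx hSA))
      fun Q hQ => ?_
    have h1 := sum_smul_mul_of_orthogonal hP ho (fun _ => 1) Finset.univ ⟨Q, hQ⟩
    simp only [one_smul, Finset.mem_univ, if_true] at h1
    have h2 : S * Q = Q := h1
    rw [sub_mul, mul_assoc, h2, sub_self]
  rw [sub_eq_zero.1 hxS, mul_assoc, hSF, mul_zero]

theorem exists_completeSequence_of_isMaximalCommutative (hA : IsMaximalCommutative A) :
    ∃ P : ℕ → SmoothOp, Function.Injective P ∧ Set.range P = canonicalSchauderBasis A ∧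
      IsCompleteSequence P ∧ ∀ n, IsOneDimensional (P n) := by
  have := (infinite_canonicalSchauderBasis hA).to_subtype
  have := (canonicalSchauderBasis_countable hA.prop).to_subtype
  obtain ⟨_⟩ := nonempty_denumerable (canonicalSchauderBasis A)
  let e : ℕ ≃ canonicalSchauderBasis A := (Denumerable.eqv _).symm
  let P : ℕ → SmoothOp := fun n => e n
  have hinj : Function.Injective P := Subtype.val_injective.comp e.injective
  have hrange : Set.range P = canonicalSchauderBasis A := by
    change Set.range (Subtype.val ∘ e) = _
    rw [e.surjective.range_comp, Subtype.range_val]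
  have hmem : ∀ n, P n ∈ canonicalSchauderBasis A := fun n => (e n).2
  refine ⟨P, hinj, hrange, ⟨fun n => (hmem n).1.2.1, fun n => (hmem n).1.2.2, fun m n hmn =>
    canonicalSchauderBasis_orthogonal hA.prop (hmem m) (hmem n) (hinj.ne hmn),
    fun Q hQ h => eq_zero_of_isMaximalCommutative hA hQ fun x hx => ?_⟩,
    fun n => isOneDimensional_of_isMaximalCommutative hA (hmem n)⟩
  -- Completeness: expanding x in the basis, PₙQ = 0 for all n gives xQ = 0.
  obtain ⟨c, hc, -⟩ := (isSchauderBasis_canonicalSchauderBasis hA.prop).infinite_case P hinj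
    hrange x hx
  refine toL2_eq_zero.1 ?_
  have h1 := ((continuous_toL2.tendsto x).comp hc).mul_const Q.toL2
  refine tendsto_nhds_unique h1 (tendsto_const_nhds.congr fun n => ?_)
  rw [Function.comp_apply, ← toL2_mul, Finset.sum_mul, Finset.sum_eq_zero, toL2_zero]
  intro i _
  rw [smul_mul_assoc, h, smul_zero]

/-- The difference w of x and its series need not be known to lie in A. If w ≠ 0, a spectral
projection Q of w*w exists in L(s',s), and wPₙ = 0 gives Pₙw* = 0, hence PₙQ = 0 for all n, against
completeness. -/
theorem eq_centralizer_of_completeSequence (hA : IsClosedCommStarSubalgebra A) {P : ℕ → SmoothOp}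
    (hmem : ∀ n, P n ∈ A) (hP : IsCompleteSequence P) (h1 : ∀ n, IsOneDimensional (P n)) :
    (A : Set SmoothOp) = Set.centralizer (A : Set SmoothOp) := by
  refine Set.Subset.antisymm (fun x hx a ha => hA.comm a ha x hx) fun x hx => ?_
  have hcomm : ∀ n, P n * x = x * P n := fun n => hx (P n) (hmem n)
  have hxP : ∀ n, ∃ c : ℂ, x * P n = c • P n := fun n => by
    obtain ⟨c, hc⟩ := (h1 n).exists_mul_mul_eq_smul x
    exact ⟨c, by rw [← hc, hcomm, mul_assoc, (hP.isProjection n).mul_self]⟩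
  choose c hc using hxP
  obtain ⟨z, hz⟩ := exists_tendsto_sum_smul hP.isProjection hP.orthogonal hc fun n => by
    rw [hcomm, hc]
  have hzA : z ∈ A := hA.isClosed.mem_of_tendsto hz (Eventually.of_forall fun n =>
    sum_mem fun i _ => A.toSubmodule.smul_mem _ (hmem i))
  have hw : ∀ n, (x - z) * P n = 0 := fun n => by
    rw [sub_mul, hc, mul_eq_smul_of_tendsto hP.isProjection hP.orthogonal hz, sub_self]
  have hxz : x - z = 0 := by
    by_contra h0
    obtain ⟨v, hv⟩ := exists_star (x - z)
    obtain ⟨Q, hQ, hQ0, ⟨r, hr, hrQ⟩, -⟩ := exists_projection_of_ne_zero hv h0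
    refine hQ0 (hP.complete Q hQ fun n => ?_)
    have hPv : P n * v = 0 := by
      have h2 := congrArg star (congrArg SmoothOp.toL2 (hw n))
      rw [toL2_mul, star_mul, (hP.isProjection n).isSelfAdjoint.star_eq, ← hv, toL2_zero,
        star_zero] at h2
      exact toL2_eq_zero.1 h2
    have h3 : (r : ℂ) • (P n * Q) = 0 := by
      rw [← mul_smul_comm, ← hrQ]
      simp only [← mul_assoc, hPv, zero_mul]
    exact (smul_eq_zero.1 h3).resolve_left (by exact_mod_cast hr.ne')
  rw [sub_eq_zero.1 hxz]
  exact hzA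

theorem isMaximalCommutative_of_eq_centralizer (hA : IsClosedCommStarSubalgebra A)
    (h : (A : Set SmoothOp) = Set.centralizer (A : Set SmoothOp)) : IsMaximalCommutative A := by
  refine ⟨hA, fun B hB hAB x hx => ?_⟩
  rw [← SetLike.mem_coe, h]
  exact fun a ha => hB.comm a (hAB ha) x hx

end SmoothOperators

end

theorem mainTheorem6
    (A : NonUnitalSubalgebra ℂ SmoothOperators.SmoothOp)
    (hA : SmoothOperators.IsClosedCommStarSubalgebra A) :
    SmoothOperators.IsSchauderBasis (SmoothOperators.canonicalSchauderBasis A) A.toSubmodule ∧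
    List.TFAE [
      SmoothOperators.IsMaximalCommutative A,
      ∃ P : ℕ → SmoothOperators.SmoothOp,
        Function.Injective P ∧
        Set.range P = SmoothOperators.canonicalSchauderBasis A ∧
        SmoothOperators.IsCompleteSequence P ∧
        ∀ n, SmoothOperators.IsOneDimensional (P n),
      (A : Set SmoothOperators.SmoothOp) = Set.centralizer (A : Set SmoothOperators.SmoothOp)] := by
  refine ⟨SmoothOperators.isSchauderBasis_canonicalSchauderBasis hA, ?_⟩
  tfae_have 1 → 2 := SmoothOperators.exists_completeSequence_of_isMaximalCommutative
  tfae_have 2 → 3 := by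
    rintro ⟨P, -, hrange, hP, h1⟩
    exact SmoothOperators.eq_centralizer_of_completeSequence hA
      (fun n => (hrange ▸ Set.mem_range_self n :
        P n ∈ SmoothOperators.canonicalSchauderBasis A).1.1) hP h1
  tfae_have 3 → 1 := SmoothOperators.isMaximalCommutative_of_eq_centralizer hA
  tfae_finish
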